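/- For each $n\in\mathbb N$ let $d_n\ge 1$ be an integer and let $X_1,\dots,X_n$ be i.i.d. uniform points in $[0,1]^{d_n}$. A point $X_i$ dominates $X_j$ if every coordinate of $X_i$ is at least the corresponding coordinate of $X_j$; $X_i$ is Pareto if it dominates no $X_j$ with $j\neq i$. Let $K_{n,d_n}$ be the number of Pareto points and, for $r\ge 1$, let $K^{(r)}_{n,d_n}$ be the number of points that dominate exactly $r$ others. Let $n$ tend to infinity along a subsequence of the positive integers (possibly all of them); all limits below, in the assumptions and in the conclusions, are taken along this subsequence. (i) If $d_n-\frac{2}{\log 2}\log n\to-\infty$, then $n-K_{n,d_n}\to\infty$ in probability. (ii) If $d_n-\frac{2}{\log 2}\log n\to c\in\mathbb R$, then $n-K_{n,d_n}$ converges in distribution to a random variable $Z_c$ with the Poisson distribution of parameter $2^{-c}$. Moreover, $$\mathbb E(n-K_{n,d_n})\to\mathbb E Z_c=2^{-c},\qquad \operatorname{Var}(n-K_{n,d_n})\to\operatorname{Var} Z_c=2^{-c},$$ and $\sum_{r=2}^{n-1}K^{(r)}_{n,d_n}\to 0$ in probability. (iii) If $d_n-\frac{2}{\log 2}\log n\to\infty$,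 then $n-K_{n,d_n}\to 0$ in probability. -/

import Mathlib

open Filter Topology MeasureTheory ProbabilityTheory

/-- `x` dominates `y` if every coordinate of `x` is at least the corresponding coordinate of `y`. -/
def Dominates {d : ℕ} (x y : Fin d → ℝ) : Prop :=
  ∀ k, y k ≤ x k

/-- The `i`-th point of the configuration `x` is Pareto if it dominates no other point. -/
def IsPareto {n d : ℕ} (x : Fin n → Fin d → ℝ) (i : Fin n) : Prop :=
  ¬ ∃ j, j ≠ i ∧ Dominates (x i) (x j)

open Classical in
/-- The number of other points of the configuration `x` dominated by its `i`-th point. -/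
noncomputable def dominatedCount {n d : ℕ} (x : Fin n → Fin d → ℝ) (i : Fin n) : ℕ :=
  (Finset.univ.filter fun j => j ≠ i ∧ Dominates (x i) (x j)).card

open Classical in
/-- The number of Pareto points of the configuration `x`. -/
noncomputable def paretoCount {n d : ℕ} (x : Fin n → Fin d → ℝ) : ℕ :=
  (Finset.univ.filter fun i => IsPareto x i).card

/-- The number of points of the configuration `x` that dominate exactly `r` others. -/
noncomputable def exactDominatingCount {n d : ℕ} (r : ℕ) (x : Fin n → Fin d → ℝ) : ℕ :=
  (Finset.univ.filter fun i => dominatedCount x i = r).card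

/-- Convergence in probability, along the filter `l`, to a real constant `a`, of random variables
that may live on different probability spaces. -/
def TendstoInProbability {ι : Type*} {Ω : ι → Type*} [∀ k, MeasurableSpace (Ω k)]
    (P : ∀ k, Measure (Ω k)) (Y : ∀ k, Ω k → ℝ) (l : Filter ι) (a : ℝ) : Prop :=
  ∀ ε : ℝ, 0 < ε → Tendsto (fun k => P k {ω | ε ≤ |Y k ω - a|}) l (𝓝 0)

/-- Convergence in probability, along the filter `l`, to `+∞`, of random variables
that may live on different probability spaces. -/
def TendstoInProbabilityAtTop {ι : Type*} {Ω : ι → Type*} [∀ k, MeasurableSpace (Ω k)]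
    (P : ∀ k, Measure (Ω k)) (Y : ∀ k, Ω k → ℝ) (l : Filter ι) : Prop :=
  ∀ M : ℝ, Tendsto (fun k => P k {ω | M ≤ Y k ω}) l (𝓝 1)

/-! Let N be the number of non-Pareto points, W the number of ordered pairs in dominance, and T the
number of triples formed by a point and two distinct points below it. Then N ≤ W ≤ N + T, E W = λ
with λ = n(n-1)/2^d = (1 - 1/n) n²/2^d, and E T ≤ n³/3^d. When d is near 2 log n / log 2, λ tends to
2^(-c), while 3^d has order n^(2 log 3/log 2) with exponent above 3, so E T → 0: N and W then have
the same limit, and points dominating two or more others disappear.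

The Poisson limit of W is a Chen–Stein argument run on characteristic functions. Domination events
with disjoint index pairs are independent, and two distinct pairs sharing an index both occur with
probability at most 3^(-d). Hence E[W f(W)] - λ E[f(W+1)] is at most 8 n³/3^d times the Lipschitz
constant of f (`norm_integral_dominatedPairCount_mul_sub_le`). With f(m) = exp(itm) this is an
approximate differential equation for the characteristic function, whose exact version has the
Poisson solution (`norm_integral_exp_sub_le`). With f(m) = m it gives E W² ≈ λ(λ+1).

For the variance of N, the bound E N² ≤ E W² is asymptotically sharp, and the matching lower bound
comes from convergence in distribution (`tendsto_integral_of_tendstoInDistribution_of_le`). In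
(iii), λ → 0 and Markov's inequality suffices. In (i), N is stochastically decreasing in d, so d may
be raised until n³/3^d → 0 while λ → ∞ still holds; Chebyshev's inequality for W finishes. -/

/-! ### Chen–Stein bound for locally dependent indicators. -/

section Stein

variable {Ω ι : Type*}

/-- The number of events `A a`, `a ∈ s`, that occur. -/
noncomputable def occurrences (A : ι → Set Ω) (s : Finset ι) (ω : Ω) : ℕ :=
  ∑ a ∈ s, (A a).indicator (fun _ => 1) ω

lemma occurrences_le_card (A : ι → Set Ω) (s : Finset ι) (ω : Ω) :
    occurrences A s ω ≤ s.card := by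
  classical
  rw [Finset.card_eq_sum_ones]
  exact Finset.sum_le_sum fun a _ => Set.indicator_le_self' (fun _ _ => Nat.zero_le _) ω

lemma cast_occurrences (A : ι → Set Ω) (s : Finset ι) (ω : Ω) :
    (occurrences A s ω : ℝ) = ∑ a ∈ s, (A a).indicator (fun _ => (1 : ℝ)) ω := by
  classical
  simp [occurrences, Set.indicator_apply]

variable [MeasurableSpace Ω] {P : Measure Ω}

lemma measurable_occurrences {A : ι → Set Ω} (hA : ∀ a, MeasurableSet (A a)) (s : Finset ι) :
    Measurable (occurrences A s) :=
  Finset.measurable_fun_sum _ fun a _ => measurable_const.indicator (hA a)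

/-- A bounded natural-valued variable takes finitely many values, so no growth condition on `f` is
needed. -/
lemma integrable_comp_of_le [IsFiniteMeasure P] {E : Type*} [NormedAddCommGroup E] {W : Ω → ℕ}
    (hW : Measurable W) {m : ℕ} (hm : ∀ ω, W ω ≤ m) (f : ℕ → E) :
    Integrable (fun ω => f (W ω)) P := by
  refine Integrable.of_bound
    ((StronglyMeasurable.of_discrete (f := f)).comp_measurable hW).aestronglyMeasurable
    (∑ k ∈ Finset.range (m + 1), ‖f k‖) (ae_of_all _ fun ω => ?_)
  exact Finset.single_le_sum (f := fun k => ‖f k‖) (fun _ _ => norm_nonneg _)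
    (Finset.mem_range.2 (Nat.lt_succ_of_le (hm ω)))

lemma integrable_comp_occurrences [IsFiniteMeasure P] {E : Type*} [NormedAddCommGroup E]
    {A : ι → Set Ω} (hA : ∀ a, MeasurableSet (A a)) (s : Finset ι) (f : ℕ → E) :
    Integrable (fun ω => f (occurrences A s ω)) P :=
  integrable_comp_of_le (measurable_occurrences hA s) (occurrences_le_card A s) f

lemma setIntegral_occurrences [IsFiniteMeasure P] {A : ι → Set Ω}
    (hA : ∀ a, MeasurableSet (A a)) (s : Finset ι) {B : Set Ω} :
    ∫ ω in B, (occurrences A s ω : ℝ) ∂P = ∑ a ∈ s, P.real (B ∩ A a) := by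
  simp_rw [cast_occurrences]
  rw [integral_finsetSum _ fun a _ => (integrable_const _).indicator (hA a)]
  refine Finset.sum_congr rfl fun a _ => ?_
  rw [integral_indicator (hA a), Measure.restrict_restrict (hA a)]
  simp [Set.inter_comm]

lemma integral_occurrences [IsFiniteMeasure P] {A : ι → Set Ω}
    (hA : ∀ a, MeasurableSet (A a)) (s : Finset ι) :
    ∫ ω, (occurrences A s ω : ℝ) ∂P = ∑ a ∈ s, P.real (A a) := by
  simpa using setIntegral_occurrences (P := P) hA s (B := Set.univ)

/-- On `A a`, the total count minus one is the count of the other events. -/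
lemma integral_occurrences_mul_sub_one [IsFiniteMeasure P] [Fintype ι] [DecidableEq ι]
    {A : ι → Set Ω} (hA : ∀ a, MeasurableSet (A a)) :
    ∫ ω, (occurrences A Finset.univ ω : ℝ) * (occurrences A Finset.univ ω - 1) ∂P =
      ∑ a, ∑ b ∈ Finset.univ.erase a, P.real (A a ∩ A b) := by
  have h : ∀ ω, (occurrences A Finset.univ ω : ℝ) * (occurrences A Finset.univ ω - 1) =
      ∑ a, (A a).indicator (fun ω => (occurrences A (Finset.univ.erase a) ω : ℝ)) ω := by
    intro ω
    nth_rw 1 [cast_occurrences]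
    rw [Finset.sum_mul]
    refine Finset.sum_congr rfl fun a _ => ?_
    by_cases h : ω ∈ A a
    · rw [occurrences, ← Finset.add_sum_erase _ _ (Finset.mem_univ a)]
      simp [h, occurrences]
    · simp [h]
  simp_rw [h]
  rw [integral_finsetSum _ fun a _ =>
    (integrable_comp_occurrences hA _ fun m => (m : ℝ)).indicator (hA a)]
  refine Finset.sum_congr rfl fun a _ => ?_
  rw [integral_indicator (hA a), setIntegral_occurrences hA]

variable [IsProbabilityMeasure P] [Fintype ι] [DecidableEq ι]

/-- Write W' for the count outside `S`, which is independent of `A a`. On `A a` the total is W' + 1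
plus the other occurrences in `S`; off it, W' + 1 differs from the total plus one by the occurrences
in `S`. The Lipschitz bound pays for both replacements, and independence factors the integral of
f(W' + 1) over `A a`. -/
lemma norm_setIntegral_sub_le {A : ι → Set Ω} (hA : ∀ a, MeasurableSet (A a)) {S : Finset ι}
    {a : ι} (ha : a ∈ S)
    (hind : IndepFun ((A a).indicator fun _ => (1 : ℕ)) (occurrences A Sᶜ) P) {f : ℕ → ℂ} {L : ℝ}
    (hf : ∀ m k, ‖f (m + k) - f m‖ ≤ L * k) :
    ‖∫ ω in A a, f (occurrences A Finset.univ ω) ∂P -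
        P.real (A a) * ∫ ω, f (occurrences A Finset.univ ω + 1) ∂P‖ ≤
      L * (∑ b ∈ S, P.real (A a) * P.real (A b) + ∑ b ∈ S.erase a, P.real (A a ∩ A b)) := by
  have hW : ∀ ω, occurrences A Finset.univ ω = occurrences A Sᶜ ω + occurrences A S ω := by
    intro ω
    rw [occurrences, ← Finset.sum_compl_add_sum S]; rfl
  have hS : ∀ ω ∈ A a, occurrences A S ω = 1 + occurrences A (S.erase a) ω := by
    intro ω hω
    rw [occurrences, ← Finset.add_sum_erase _ _ ha, Set.indicator_of_mem hω]; rfl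
  have h2 : ∫ ω in A a, f (occurrences A Sᶜ ω + 1) ∂P =
      P.real (A a) * ∫ ω, f (occurrences A Sᶜ ω + 1) ∂P := by
    have h := hind.integral_comp_mul_comp (𝕜 := ℂ) (f := fun m : ℕ => (m : ℂ))
      (g := fun m : ℕ => f (m + 1))
      (measurable_const.indicator (hA a)).aemeasurable
      (measurable_occurrences hA _).aemeasurable
      .of_discrete .of_discrete
    have e1 : ((fun m : ℕ => (m : ℂ)) ∘ (A a).indicator fun _ => (1 : ℕ)) =
        (A a).indicator fun _ => (1 : ℂ) := by
      ext ω; by_cases h : ω ∈ A a <;> simp [h]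
    have e2 : (((fun m : ℕ => (m : ℂ)) ∘ (A a).indicator fun _ => (1 : ℕ)) *
        ((fun m => f (m + 1)) ∘ occurrences A Sᶜ)) =
        (A a).indicator fun ω => f (occurrences A Sᶜ ω + 1) := by
      ext ω; by_cases h : ω ∈ A a <;> simp [h]
    rw [e2, e1, integral_indicator (hA a), integral_indicator (hA a)] at h
    simpa using h
  have h1 : ‖∫ ω in A a, f (occurrences A Finset.univ ω) ∂P -
      ∫ ω in A a, f (occurrences A Sᶜ ω + 1) ∂P‖ ≤ L * ∑ b ∈ S.erase a, P.real (A a ∩ A b) := by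
    rw [← integral_sub (integrable_comp_occurrences hA _ _)
      (integrable_comp_occurrences hA _ fun m => f (m + 1)), ← setIntegral_occurrences hA,
      ← integral_const_mul]
    refine norm_integral_le_of_norm_le ((integrable_comp_occurrences hA _ fun m => (m : ℝ)).const_mul
      L) ((ae_restrict_iff' (hA a)).2 (ae_of_all _ fun ω hω => ?_))
    rw [hW, hS ω hω, ← add_assoc]
    exact hf _ _
  have h3 : ‖∫ ω, f (occurrences A Finset.univ ω + 1) ∂P -
      ∫ ω, f (occurrences A Sᶜ ω + 1) ∂P‖ ≤ L * ∑ b ∈ S, P.real (A b) := by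
    rw [← integral_sub (integrable_comp_occurrences hA _ fun m => f (m + 1))
      (integrable_comp_occurrences hA _ fun m => f (m + 1)), ← integral_occurrences hA,
      ← integral_const_mul]
    refine norm_integral_le_of_norm_le ((integrable_comp_occurrences hA _ fun m => (m : ℝ)).const_mul
      L) (ae_of_all _ fun ω => ?_)
    rw [hW, add_right_comm]
    exact hf _ _
  rw [← Finset.mul_sum]
  calc _ = ‖(∫ ω in A a, f (occurrences A Finset.univ ω) ∂P -
        ∫ ω in A a, f (occurrences A Sᶜ ω + 1) ∂P) - P.real (A a) *
        (∫ ω, f (occurrences A Finset.univ ω + 1) ∂P -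
          ∫ ω, f (occurrences A Sᶜ ω + 1) ∂P)‖ := by rw [h2]; ring_nf
    _ ≤ _ := norm_sub_le _ _
    _ ≤ L * ∑ b ∈ S.erase a, P.real (A a ∩ A b) +
        P.real (A a) * (L * ∑ b ∈ S, P.real (A b)) := by
      rw [norm_mul, Complex.norm_real, Real.norm_of_nonneg measureReal_nonneg]
      gcongr
    _ = _ := by ring

/-- Stein's identity for sums of locally dependent indicators holds up to the usual
Chen–Stein error terms. -/
theorem norm_integral_mul_sub_le {A : ι → Set Ω} (hA : ∀ a, MeasurableSet (A a))
    {S : ι → Finset ι} (hS : ∀ a, a ∈ S a)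
    (hind : ∀ a, IndepFun ((A a).indicator fun _ => (1 : ℕ)) (occurrences A (S a)ᶜ) P)
    {f : ℕ → ℂ} {L : ℝ} (hf : ∀ m k, ‖f (m + k) - f m‖ ≤ L * k) :
    ‖∫ ω, occurrences A Finset.univ ω * f (occurrences A Finset.univ ω) ∂P -
        ∑ a, P.real (A a) * ∫ ω, f (occurrences A Finset.univ ω + 1) ∂P‖ ≤
      L * ∑ a, (∑ b ∈ S a, P.real (A a) * P.real (A b) +
        ∑ b ∈ (S a).erase a, P.real (A a ∩ A b)) := by
  have h : ∫ ω, occurrences A Finset.univ ω * f (occurrences A Finset.univ ω) ∂P =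
      ∑ a, ∫ ω in A a, f (occurrences A Finset.univ ω) ∂P := by
    simp_rw [← integral_indicator (hA _)]
    rw [← integral_finsetSum _ fun a _ => (integrable_comp_occurrences hA _ _).indicator (hA a)]
    congr 1 with ω
    nth_rw 1 [occurrences]
    push_cast
    rw [Finset.sum_mul]
    refine Finset.sum_congr rfl fun a _ => ?_
    by_cases h : ω ∈ A a <;> simp [h]
  rw [h, ← Finset.sum_sub_distrib, Finset.mul_sum]
  exact norm_sum_le_of_le _ fun a _ => norm_setIntegral_sub_le hA (hS a) (hind a) hf

end Stein

/-! ### Orthant probabilities for the uniform law on the cube. -/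

section UniformCube

/-- The uniform distribution on the unit interval. -/
noncomputable def unitUniform : Measure ℝ := volume.restrict (Set.Icc 0 1)

instance : IsProbabilityMeasure unitUniform := ⟨by simp [unitUniform]⟩

lemma cond_Icc_eq_pi (d : ℕ) :
    ProbabilityTheory.cond (volume : Measure (Fin d → ℝ)) (Set.Icc 0 1) =
      Measure.pi fun _ => unitUniform := by
  have h : (Set.Icc 0 1 : Set (Fin d → ℝ)) = Set.univ.pi fun _ => Set.Icc 0 1 :=
    (Set.pi_univ_Icc _ _).symm
  have h1 : volume (Set.Icc 0 1 : Set (Fin d → ℝ)) = 1 := by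
    simp [Real.volume_Icc_pi]
  rw [ProbabilityTheory.cond, h1, inv_one, one_smul, h, volume_pi, Measure.restrict_pi_pi]
  rfl

lemma unitUniform_real_Iic {x : ℝ} (hx : x ∈ Set.Icc (0 : ℝ) 1) :
    unitUniform.real (Set.Iic x) = x := by
  have : Set.Iic x ∩ Set.Icc 0 1 = Set.Icc 0 x := by
    ext y; simp only [Set.mem_inter_iff, Set.mem_Iic, Set.mem_Icc] at *; grind
  rw [measureReal_def, unitUniform, Measure.restrict_apply measurableSet_Iic, this]
  simp [hx.1]

lemma unitUniform_real_Ici {x : ℝ} (hx : x ∈ Set.Icc (0 : ℝ) 1) :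
    unitUniform.real (Set.Ici x) = 1 - x := by
  have : Set.Ici x ∩ Set.Icc 0 1 = Set.Icc x 1 := by
    ext y; simp only [Set.mem_inter_iff, Set.mem_Ici, Set.mem_Icc] at *; grind
  rw [measureReal_def, unitUniform, Measure.restrict_apply measurableSet_Ici, this]
  simp [hx.2]

lemma integral_unitUniform_Iic_pow (r : ℕ) :
    ∫ x, unitUniform.real (Set.Iic x) ^ r ∂unitUniform = ((r : ℝ) + 1)⁻¹ := by
  have h : ∫ x in Set.Icc 0 1, unitUniform.real (Set.Iic x) ^ r =
      ∫ x in Set.Icc (0 : ℝ) 1, x ^ r :=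
    setIntegral_congr_fun measurableSet_Icc fun x hx => by
      simp only [unitUniform_real_Iic hx]
  refine h.trans ?_
  rw [integral_Icc_eq_integral_Ioc, ← intervalIntegral.integral_of_le zero_le_one]
  simp [integral_pow]

lemma integral_unitUniform_Ici_pow (r : ℕ) :
    ∫ x, unitUniform.real (Set.Ici x) ^ r ∂unitUniform = ((r : ℝ) + 1)⁻¹ := by
  have h : ∫ x in Set.Icc 0 1, unitUniform.real (Set.Ici x) ^ r =
      ∫ x in Set.Icc (0 : ℝ) 1, (1 - x) ^ r :=
    setIntegral_congr_fun measurableSet_Icc fun x hx => by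
      simp only [unitUniform_real_Ici hx]
  refine h.trans ?_
  rw [integral_Icc_eq_integral_Ioc, ← intervalIntegral.integral_of_le zero_le_one,
    intervalIntegral.integral_comp_sub_left (fun x => x ^ r)]
  simp [integral_pow]

variable {d : ℕ}

lemma pi_unitUniform_real_Iic (x : Fin d → ℝ) :
    (Measure.pi fun _ : Fin d => unitUniform).real (Set.Iic x) =
      ∏ k, unitUniform.real (Set.Iic (x k)) := by
  rw [← Set.pi_univ_Iic, measureReal_def, Measure.pi_pi, ENNReal.toReal_prod]
  rfl

lemma pi_unitUniform_real_Ici (x : Fin d → ℝ) :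
    (Measure.pi fun _ : Fin d => unitUniform).real (Set.Ici x) =
      ∏ k, unitUniform.real (Set.Ici (x k)) := by
  rw [← Set.pi_univ_Ici, measureReal_def, Measure.pi_pi, ENNReal.toReal_prod]
  rfl

/-- This is the probability that `r` independent points all lie below a further one: the coordinates
factor, each contributing the integral of x^r over [0,1]. -/
lemma integral_pi_unitUniform_Iic_pow (d r : ℕ) :
    ∫ x, (Measure.pi fun _ : Fin d => unitUniform).real (Set.Iic x) ^ r
      ∂(Measure.pi fun _ : Fin d => unitUniform) = (((r : ℝ) + 1) ^ d)⁻¹ := by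
  simp_rw [pi_unitUniform_real_Iic, ← Finset.prod_pow]
  rw [integral_fintype_prod_eq_pow (fun t => unitUniform.real (Set.Iic t) ^ r),
    integral_unitUniform_Iic_pow, Fintype.card_fin, inv_pow]

lemma integral_pi_unitUniform_Ici_pow (d r : ℕ) :
    ∫ x, (Measure.pi fun _ : Fin d => unitUniform).real (Set.Ici x) ^ r
      ∂(Measure.pi fun _ : Fin d => unitUniform) = (((r : ℝ) + 1) ^ d)⁻¹ := by
  simp_rw [pi_unitUniform_real_Ici, ← Finset.prod_pow]
  rw [integral_fintype_prod_eq_pow (fun t => unitUniform.real (Set.Ici t) ^ r),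
    integral_unitUniform_Ici_pow, Fintype.card_fin, inv_pow]

end UniformCube

/-! ### Probabilities and independence of domination events. -/

section Sample

variable {Ω : Type*} [MeasurableSpace Ω] {n d : ℕ}

/-- `X` consists of independent points, uniformly distributed in the unit cube. -/
structure IsUniformSample (P : Measure Ω) (X : Fin n → Ω → Fin d → ℝ) : Prop where
  measurable : ∀ i, Measurable (X i)
  indep : iIndepFun X P
  map_eq : ∀ i, P.map (X i) = Measure.pi fun _ => unitUniform

lemma measureReal_prodMk_mem_of_indepFun {α β : Type*} [MeasurableSpace α] [MeasurableSpace β]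
    {P : Measure Ω} [IsProbabilityMeasure P] {Y : Ω → α} {Z : Ω → β} (hY : Measurable Y)
    (hZ : Measurable Z) (h : IndepFun Y Z P) {s : Set (α × β)} (hs : MeasurableSet s) :
    P.real {ω | (Y ω, Z ω) ∈ s} = ∫ y, (P.map Z).real (Prod.mk y ⁻¹' s) ∂(P.map Y) := by
  have := Measure.isProbabilityMeasure_map (μ := P) hZ.aemeasurable
  have := Measure.isProbabilityMeasure_map (μ := P) hY.aemeasurable
  have h1 : P {ω | (Y ω, Z ω) ∈ s} = (P.map fun ω => (Y ω, Z ω)) s := by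
    rw [Measure.map_apply (hY.prodMk hZ) hs]; rfl
  rw [measureReal_def, h1, (indepFun_iff_map_prod_eq_prod_map_map hY.aemeasurable
    hZ.aemeasurable).1 h, Measure.prod_apply hs]
  simp_rw [measureReal_def]
  rw [integral_toReal (measurable_measure_prodMk_left hs).aemeasurable
    (ae_of_all _ fun _ => measure_lt_top _ _)]

namespace IsUniformSample

variable {P : Measure Ω} [IsProbabilityMeasure P] {X : Fin n → Ω → Fin d → ℝ}

lemma measureReal_le (hX : IsUniformSample P X) {i j : Fin n} (hij : i ≠ j) :
    P.real {ω | X j ω ≤ X i ω} = (2 ^ d : ℝ)⁻¹ := by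
  have h := measureReal_prodMk_mem_of_indepFun (hX.measurable i) (hX.measurable j)
    (hX.indep.indepFun hij) (s := {p | p.2 ≤ p.1}) (measurableSet_le measurable_snd measurable_fst)
  have h2 := integral_pi_unitUniform_Iic_pow d 1
  rw [hX.map_eq, hX.map_eq] at h
  simp only [pow_one, Nat.cast_one, one_add_one_eq_two] at h2
  exact h.trans h2

lemma map_prodMk_eq (hX : IsUniformSample P X) {i j : Fin n} (hij : i ≠ j) :
    P.map (fun ω => (X i ω, X j ω)) =
      (Measure.pi fun _ => unitUniform).prod (Measure.pi fun _ => unitUniform) := by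
  rw [(indepFun_iff_map_prod_eq_prod_map_map (hX.measurable i).aemeasurable
    (hX.measurable j).aemeasurable).1 (hX.indep.indepFun hij), hX.map_eq, hX.map_eq]

lemma measureReal_le_inter_le (hX : IsUniformSample P X) {i j l : Fin n} (hij : i ≠ j)
    (hil : i ≠ l) (hjl : j ≠ l) :
    P.real {ω | X j ω ≤ X i ω ∧ X l ω ≤ X i ω} = (3 ^ d : ℝ)⁻¹ := by
  have hs : MeasurableSet {p : (Fin d → ℝ) × (Fin d → ℝ) × (Fin d → ℝ) |
      p.2.1 ≤ p.1 ∧ p.2.2 ≤ p.1} :=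
    (measurableSet_le measurable_snd.fst measurable_fst).inter
      (measurableSet_le measurable_snd.snd measurable_fst)
  have h := measureReal_prodMk_mem_of_indepFun (hX.measurable i)
    ((hX.measurable j).prodMk (hX.measurable l))
    (hX.indep.indepFun_prodMk hX.measurable j l i hij.symm hil.symm).symm hs
  have h2 := integral_pi_unitUniform_Iic_pow d 2
  rw [hX.map_eq, hX.map_prodMk_eq hjl] at h
  have h3 : ∀ x : Fin d → ℝ, (Prod.mk x ⁻¹' {p : (Fin d → ℝ) × (Fin d → ℝ) × (Fin d → ℝ) |
      p.2.1 ≤ p.1 ∧ p.2.2 ≤ p.1}) = Set.Iic x ×ˢ Set.Iic x := fun x => rfl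
  simp_rw [h3, measureReal_prod_prod, ← pow_two] at h
  norm_num at h2
  exact h.trans h2

lemma measureReal_ge_inter_ge (hX : IsUniformSample P X) {i j l : Fin n} (hij : i ≠ j)
    (hil : i ≠ l) (hjl : j ≠ l) :
    P.real {ω | X i ω ≤ X j ω ∧ X i ω ≤ X l ω} = (3 ^ d : ℝ)⁻¹ := by
  have hs : MeasurableSet {p : (Fin d → ℝ) × (Fin d → ℝ) × (Fin d → ℝ) |
      p.1 ≤ p.2.1 ∧ p.1 ≤ p.2.2} :=
    (measurableSet_le measurable_fst measurable_snd.fst).inter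
      (measurableSet_le measurable_fst measurable_snd.snd)
  have h := measureReal_prodMk_mem_of_indepFun (hX.measurable i)
    ((hX.measurable j).prodMk (hX.measurable l))
    (hX.indep.indepFun_prodMk hX.measurable j l i hij.symm hil.symm).symm hs
  have h2 := integral_pi_unitUniform_Ici_pow d 2
  rw [hX.map_eq, hX.map_prodMk_eq hjl] at h
  have h3 : ∀ x : Fin d → ℝ, (Prod.mk x ⁻¹' {p : (Fin d → ℝ) × (Fin d → ℝ) × (Fin d → ℝ) |
      p.1 ≤ p.2.1 ∧ p.1 ≤ p.2.2}) = Set.Ici x ×ˢ Set.Ici x := fun x => rfl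
  simp_rw [h3, measureReal_prod_prod, ← pow_two] at h
  norm_num at h2
  exact h.trans h2

instance : NullSingletonClass unitUniform := by unfold unitUniform; infer_instance

/-- Mutual domination forces equality of two independent points with atomless law. In dimension 0
all points coincide, whence `1 ≤ d`. -/
lemma measureReal_le_inter_ge (hX : IsUniformSample P X) (hd : 1 ≤ d) {i j : Fin n}
    (hij : i ≠ j) : P.real {ω | X j ω ≤ X i ω ∧ X i ω ≤ X j ω} = 0 := by
  have hs : MeasurableSet {p : (Fin d → ℝ) × (Fin d → ℝ) | p.2 ≤ p.1 ∧ p.1 ≤ p.2} :=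
    (measurableSet_le measurable_snd measurable_fst).inter
      (measurableSet_le measurable_fst measurable_snd)
  have h := measureReal_prodMk_mem_of_indepFun (hX.measurable i) (hX.measurable j)
    (hX.indep.indepFun hij) hs
  have h3 : ∀ x : Fin d → ℝ, (Prod.mk x ⁻¹' {p : (Fin d → ℝ) × (Fin d → ℝ) |
      p.2 ≤ p.1 ∧ p.1 ≤ p.2}) = {x} := fun x => by
    ext y; exact ⟨fun h => le_antisymm h.1 h.2, fun h => by rw [h]; exact ⟨le_rfl, le_rfl⟩⟩
  have : Nonempty (Fin d) := ⟨⟨0, hd⟩⟩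
  rw [hX.map_eq, hX.map_eq] at h
  simp_rw [h3, measureReal_def, measure_singleton] at h
  simpa [measureReal_def] using h

end IsUniformSample

/-- The event that `p.1` and `p.2` are distinct and the first point dominates the second one. -/
def dominationEvent {Ω' : Type*} (X : Fin n → Ω' → Fin d → ℝ) (p : Fin n × Fin n) : Set Ω' :=
  {ω | p.1 ≠ p.2 ∧ X p.2 ω ≤ X p.1 ω}

lemma measurableSet_dominationEvent {X : Fin n → Ω → Fin d → ℝ} (hX : ∀ i, Measurable (X i))
    (p : Fin n × Fin n) : MeasurableSet (dominationEvent X p) :=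
  (MeasurableSet.const _).inter (measurableSet_le (hX _) (hX _))

/-- The pairs that have an index in common with `p`. -/
def neighbours (p : Fin n × Fin n) : Finset (Fin n × Fin n) :=
  Finset.univ.filter fun q => (q.1 = p.1 ∨ q.1 = p.2) ∨ q.2 = p.1 ∨ q.2 = p.2

lemma card_neighbours_le (p : Fin n × Fin n) : (neighbours p).card ≤ 4 * n := by
  have h1 : ∀ a : Fin n, (Finset.univ.filter fun q : Fin n × Fin n => q.1 = a).card = n := by
    intro a
    have : (Finset.univ.filter fun q : Fin n × Fin n => q.1 = a) = {a} ×ˢ Finset.univ := by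
      ext q; simp [Prod.ext_iff, eq_comm]
    rw [this, Finset.card_product]; simp
  have h2 : ∀ a : Fin n, (Finset.univ.filter fun q : Fin n × Fin n => q.2 = a).card = n := by
    intro a
    have : (Finset.univ.filter fun q : Fin n × Fin n => q.2 = a) = Finset.univ ×ˢ {a} := by
      ext q; simp [Prod.ext_iff, eq_comm]
    rw [this, Finset.card_product]; simp
  simp only [neighbours, Finset.filter_or]
  refine (Finset.card_union_le _ _).trans ?_
  have h3 := Finset.card_union_le (Finset.univ.filter fun q : Fin n × Fin n => q.1 = p.1)
    (Finset.univ.filter fun q : Fin n × Fin n => q.1 = p.2)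
  have h4 := Finset.card_union_le (Finset.univ.filter fun q : Fin n × Fin n => q.2 = p.1)
    (Finset.univ.filter fun q : Fin n × Fin n => q.2 = p.2)
  rw [h1, h1] at h3
  rw [h2, h2] at h4
  lia

/-- Extension by zero of a partially defined configuration. -/
noncomputable def extendByZero (T : Finset (Fin n)) (k : Fin n) (v : T → Fin d → ℝ) :
    Fin d → ℝ :=
  if h : k ∈ T then v ⟨k, h⟩ else 0

lemma measurable_extendByZero (T : Finset (Fin n)) (k : Fin n) :
    Measurable (extendByZero (d := d) T k) := by
  unfold extendByZero
  split_ifs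
  · exact measurable_pi_apply _
  · exact measurable_const

namespace IsUniformSample

variable {P : Measure Ω} [IsProbabilityMeasure P] {X : Fin n → Ω → Fin d → ℝ}

/-- Both variables are functions of subfamilies of the sample with disjoint index sets.
`extendByZero` lets the same formula for the events be evaluated on a subfamily; the zeros are never
read. -/
lemma indepFun_dominationEvent (hX : IsUniformSample P X) (p : Fin n × Fin n) :
    IndepFun ((dominationEvent X p).indicator fun _ => (1 : ℕ))
      (occurrences (dominationEvent X) (neighbours p)ᶜ) P := by
  have h := hX.indep.indepFun_finset {p.1, p.2} {p.1, p.2}ᶜ disjoint_compl_right hX.measurable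
  have hφ : Measurable
      ((dominationEvent (extendByZero (d := d) {p.1, p.2}) p).indicator fun _ => (1 : ℕ)) :=
    measurable_const.indicator (measurableSet_dominationEvent (measurable_extendByZero _) _)
  have h' := h.comp
    (φ := (dominationEvent (extendByZero (d := d) {p.1, p.2}) p).indicator fun _ => (1 : ℕ))
    (ψ := occurrences (dominationEvent (extendByZero (d := d) {p.1, p.2}ᶜ)) (neighbours p)ᶜ)
    hφ (measurable_occurrences (measurableSet_dominationEvent (measurable_extendByZero _)) _)
  convert h' using 1
  · ext ω
    simp [dominationEvent, extendByZero]
    rfl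
  · ext ω
    refine Finset.sum_congr rfl fun q hq => ?_
    simp only [neighbours, Finset.mem_compl, Finset.mem_filter, Finset.mem_univ, true_and,
      not_or] at hq
    simp [dominationEvent, extendByZero, hq]
    rfl

lemma measureReal_dominationEvent (hX : IsUniformSample P X) (p : Fin n × Fin n) :
    P.real (dominationEvent X p) = if p.1 = p.2 then 0 else (2 ^ d : ℝ)⁻¹ := by
  split_ifs with h
  · simp [dominationEvent, h]
  · simpa [dominationEvent, h] using hX.measureReal_le h

/-- Two distinct pairs sharing an index form a common dominator, a common dominated point, a chain
or a reversed pair. In a chain the top point dominates the other two by transitivity, so the first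
three cases have probability at most 3^(-d); the last is null. -/
lemma measureReal_dominationEvent_inter_le (hX : IsUniformSample P X) (hd : 1 ≤ d)
    {p q : Fin n × Fin n} (hq : q ∈ neighbours p) (hqp : q ≠ p) :
    P.real (dominationEvent X p ∩ dominationEvent X q) ≤ (3 ^ d : ℝ)⁻¹ := by
  obtain ⟨i, j⟩ := p
  obtain ⟨k, l⟩ := q
  have h0 : (0 : ℝ) ≤ (3 ^ d : ℝ)⁻¹ := by positivity
  by_cases hij : i = j
  · simp [dominationEvent, hij]
  by_cases hkl : k = l
  · simp [dominationEvent, hkl]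
  simp only [neighbours, Finset.mem_filter, Finset.mem_univ, true_and] at hq
  simp only [ne_eq, Prod.mk.injEq, not_and] at hqp
  rcases hq with (rfl | rfl) | rfl | rfl
  · rw [← hX.measureReal_le_inter_le hij hkl fun h => hqp rfl h.symm]
    exact measureReal_mono fun ω h => ⟨h.1.2, h.2.2⟩
  · by_cases hil : i = l
    · subst hil
      refine le_trans ?_ h0
      rw [← hX.measureReal_le_inter_ge hd hij]
      exact measureReal_mono fun ω h => ⟨h.1.2, h.2.2⟩
    · rw [← hX.measureReal_le_inter_le hij hil hkl]
      exact measureReal_mono fun ω h => ⟨h.1.2, h.2.2.trans h.1.2⟩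
  · by_cases hjk : j = k
    · subst hjk
      refine le_trans ?_ h0
      rw [← hX.measureReal_le_inter_ge hd hij]
      exact measureReal_mono fun ω h => ⟨h.1.2, h.2.2⟩
    · rw [← hX.measureReal_le_inter_le hkl (Ne.symm hjk) hij]
      exact measureReal_mono fun ω h => ⟨h.2.2, h.1.2.trans h.2.2⟩
  · rw [← hX.measureReal_ge_inter_ge (Ne.symm hij) (Ne.symm hkl) fun h => hqp h.symm rfl]
    exact measureReal_mono fun ω h => ⟨h.1.2, h.2.2⟩

end IsUniformSample

end Sample

/-! ### Deterministic comparison of the counts. -/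

section Counts

variable {n d : ℕ}

/-- The number of ordered pairs in dominance. -/
noncomputable def dominatedPairCount (x : Fin n → Fin d → ℝ) : ℕ := ∑ i, dominatedCount x i

/-- The number of non-Pareto points. -/
noncomputable def nonParetoCount (x : Fin n → Fin d → ℝ) : ℕ :=
  (Finset.univ.filter fun i => 1 ≤ dominatedCount x i).card

/-- The number of triples consisting of a point and two distinct points dominated by it. -/
noncomputable def dominatedTripleCount (x : Fin n → Fin d → ℝ) : ℕ :=
  ∑ i, dominatedCount x i * (dominatedCount x i - 1)

lemma isPareto_iff_dominatedCount {x : Fin n → Fin d → ℝ} {i : Fin n} :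
    IsPareto x i ↔ ¬ 1 ≤ dominatedCount x i := by
  classical
  simp [IsPareto, dominatedCount, Nat.one_le_iff_ne_zero, Finset.filter_eq_empty_iff]

lemma nat_sub_paretoCount (x : Fin n → Fin d → ℝ) :
    (n : ℝ) - paretoCount x = nonParetoCount x := by
  classical
  have h := Finset.card_filter_add_card_filter_not (s := (Finset.univ : Finset (Fin n)))
    (fun i => 1 ≤ dominatedCount x i)
  have h2 : paretoCount x = (Finset.univ.filter fun i => ¬ 1 ≤ dominatedCount x i).card := by
    simp only [paretoCount, isPareto_iff_dominatedCount]
  rw [← h2, Finset.card_univ, Fintype.card_fin] at h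
  rw [sub_eq_iff_eq_add]
  exact_mod_cast h.symm

lemma nonParetoCount_le_dominatedPairCount (x : Fin n → Fin d → ℝ) :
    nonParetoCount x ≤ dominatedPairCount x := by
  rw [nonParetoCount, Finset.card_filter]
  exact Finset.sum_le_sum fun i _ => by split_ifs <;> lia

/-- Pointwise, m ≤ 1{m ≥ 1} + m(m-1) for every natural m. -/
lemma dominatedPairCount_le (x : Fin n → Fin d → ℝ) :
    dominatedPairCount x ≤ nonParetoCount x + dominatedTripleCount x := by
  rw [nonParetoCount, Finset.card_filter, dominatedTripleCount, ← Finset.sum_add_distrib]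
  refine Finset.sum_le_sum fun i _ => ?_
  generalize dominatedCount x i = m
  rcases m with _ | m
  · simp
  · simp; nlinarith

/-- Each point counted on the left dominates m ≥ 2 others and contributes m(m-1) ≥ 1 on the right.
-/
lemma sum_exactDominatingCount_le (x : Fin n → Fin d → ℝ) :
    ∑ r ∈ Finset.Icc 2 (n - 1), exactDominatingCount r x ≤ dominatedTripleCount x := by
  simp_rw [exactDominatingCount, Finset.card_filter]
  rw [Finset.sum_comm]
  refine Finset.sum_le_sum fun i _ => ?_
  rw [Finset.sum_ite_eq]
  split_ifs with h
  · rw [Finset.mem_Icc] at h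
    nlinarith [Nat.le_sub_one_of_lt h.1]
  · exact Nat.zero_le _

lemma nonParetoCount_mono {d' : ℕ} {x : Fin n → Fin d → ℝ} {y : Fin n → Fin d' → ℝ}
    (h : ∀ i j, Dominates (y i) (y j) → Dominates (x i) (x j)) :
    nonParetoCount y ≤ nonParetoCount x := by
  classical
  refine Finset.card_le_card fun i => ?_
  simp only [Finset.mem_filter, Finset.mem_univ, true_and]
  intro hi
  refine hi.trans (Finset.card_le_card fun j => ?_)
  simp only [Finset.mem_filter, Finset.mem_univ, true_and]
  exact fun hj => ⟨hj.1, h i j hj.2⟩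

variable {Ω : Type*}

lemma dominatedCount_eq_occurrences (X : Fin n → Ω → Fin d → ℝ) (i : Fin n) (ω : Ω) :
    dominatedCount (fun i => X i ω) i =
      occurrences (fun j => dominationEvent X (i, j)) Finset.univ ω := by
  classical
  rw [dominatedCount, Finset.card_filter]
  refine Finset.sum_congr rfl fun j _ => ?_
  simp only [Set.indicator_apply, dominationEvent, Set.mem_ofPred_eq, ne_comm (a := j)]
  rfl

lemma dominatedPairCount_eq_occurrences (X : Fin n → Ω → Fin d → ℝ) (ω : Ω) :
    dominatedPairCount (fun i => X i ω) = occurrences (dominationEvent X) Finset.univ ω := by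
  simp only [dominatedPairCount, dominatedCount_eq_occurrences, occurrences]
  rw [Fintype.sum_prod_type]

lemma dominatedPairCount_le_card (X : Fin n → Ω → Fin d → ℝ) (ω : Ω) :
    dominatedPairCount (fun i => X i ω) ≤ (Finset.univ : Finset (Fin n × Fin n)).card := by
  rw [dominatedPairCount_eq_occurrences]
  exact occurrences_le_card _ _ _

end Counts

/-! ### Expectations and the Stein bound for the pair and triple counts. -/

namespace IsUniformSample

variable {Ω : Type*} [MeasurableSpace Ω] {n d : ℕ} {P : Measure Ω} {X : Fin n → Ω → Fin d → ℝ}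

lemma measurable_dominatedCount (hX : IsUniformSample P X) (i : Fin n) :
    Measurable fun ω => dominatedCount (fun i => X i ω) i := by
  simp_rw [dominatedCount_eq_occurrences]
  exact measurable_occurrences (fun j => measurableSet_dominationEvent hX.measurable _) _

lemma measurable_dominatedPairCount (hX : IsUniformSample P X) :
    Measurable fun ω => dominatedPairCount fun i => X i ω :=
  Finset.measurable_fun_sum _ fun i _ => hX.measurable_dominatedCount i

lemma measurable_nonParetoCount (hX : IsUniformSample P X) :
    Measurable fun ω => nonParetoCount fun i => X i ω := by
  simp_rw [nonParetoCount, Finset.card_filter]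
  exact Finset.measurable_fun_sum _ fun i _ => Measurable.ite
    (hX.measurable_dominatedCount i measurableSet_Ici) measurable_const measurable_const

lemma measurable_cast_nonParetoCount (hX : IsUniformSample P X) :
    Measurable fun ω => (nonParetoCount fun i => X i ω : ℝ) :=
  (measurable_from_top (f := fun m : ℕ => (m : ℝ))).comp hX.measurable_nonParetoCount

lemma measurable_dominatedTripleCount (hX : IsUniformSample P X) :
    Measurable fun ω => dominatedTripleCount fun i => X i ω :=
  Finset.measurable_fun_sum _ fun i _ =>
    (measurable_from_top (f := fun m : ℕ => m * (m - 1))).comp (hX.measurable_dominatedCount i)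

variable [IsProbabilityMeasure P]

lemma integrable_comp_dominatedPairCount (hX : IsUniformSample P X) {E : Type*}
    [NormedAddCommGroup E] (f : ℕ → E) :
    Integrable (fun ω => f (dominatedPairCount fun i => X i ω)) P :=
  integrable_comp_of_le hX.measurable_dominatedPairCount (dominatedPairCount_le_card X) f

lemma integrable_comp_nonParetoCount (hX : IsUniformSample P X) {E : Type*}
    [NormedAddCommGroup E] (f : ℕ → E) :
    Integrable (fun ω => f (nonParetoCount fun i => X i ω)) P :=
  integrable_comp_of_le hX.measurable_nonParetoCount
    (fun ω => (nonParetoCount_le_dominatedPairCount _).trans (dominatedPairCount_le_card X ω)) f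

lemma sum_measureReal_dominationEvent (hX : IsUniformSample P X) :
    ∑ p, P.real (dominationEvent X p) = n * (n - 1) / 2 ^ d := by
  simp_rw [hX.measureReal_dominationEvent]
  rw [Fintype.sum_prod_type]
  have h : ∀ i : Fin n, ∑ j : Fin n, (if i = j then 0 else (2 ^ d : ℝ)⁻¹) =
      (n - 1) * (2 ^ d : ℝ)⁻¹ := by
    intro i
    have h' : ∀ j : Fin n, (if i = j then 0 else (2 ^ d : ℝ)⁻¹) =
        (2 ^ d : ℝ)⁻¹ - if i = j then (2 ^ d : ℝ)⁻¹ else 0 := by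
      intro j; split_ifs <;> simp
    simp_rw [h']
    rw [Finset.sum_sub_distrib, Finset.sum_ite_eq]
    simp
    ring
  simp only [h, Finset.sum_const, Finset.card_univ, Fintype.card_fin, nsmul_eq_mul]
  ring

lemma integral_dominatedPairCount (hX : IsUniformSample P X) :
    ∫ ω, (dominatedPairCount fun i => X i ω : ℝ) ∂P = n * (n - 1) / 2 ^ d := by
  simp_rw [dominatedPairCount_eq_occurrences]
  rw [integral_occurrences (measurableSet_dominationEvent hX.measurable),
    hX.sum_measureReal_dominationEvent]

/-- The number of dominating pairs nearly satisfies Stein's identity for the Poisson law. -/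
lemma norm_integral_dominatedPairCount_mul_sub_le (hX : IsUniformSample P X) (hd : 1 ≤ d)
    {f : ℕ → ℂ} {L : ℝ} (hf : ∀ m k, ‖f (m + k) - f m‖ ≤ L * k) :
    ‖∫ ω, (dominatedPairCount fun i => X i ω) * f (dominatedPairCount fun i => X i ω) ∂P -
        ((n * (n - 1) / 2 ^ d : ℝ) : ℂ) *
          ∫ ω, f ((dominatedPairCount fun i => X i ω) + 1) ∂P‖ ≤
      L * (8 * (n ^ 3 / 3 ^ d)) := by
  have hL : 0 ≤ L := by simpa using (norm_nonneg _).trans (hf 0 1)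
  simp_rw [dominatedPairCount_eq_occurrences]
  have h := norm_integral_mul_sub_le (P := P) (measurableSet_dominationEvent hX.measurable)
    (S := neighbours) (fun p => by simp [neighbours]) hX.indepFun_dominationEvent hf
  rw [← Finset.sum_mul, ← Complex.ofReal_sum, hX.sum_measureReal_dominationEvent] at h
  refine h.trans (mul_le_mul_of_nonneg_left ?_ hL)
  have hcard : ∀ p : Fin n × Fin n, ((neighbours p).card : ℝ) ≤ 4 * n :=
    fun p => by exact_mod_cast card_neighbours_le p
  have hcard' : ∀ p : Fin n × Fin n, (((neighbours p).erase p).card : ℝ) ≤ 4 * n :=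
    fun p => le_trans (by exact_mod_cast Finset.card_erase_le) (hcard p)
  have hle : ∀ p : Fin n × Fin n, P.real (dominationEvent X p) ≤ (2 ^ d : ℝ)⁻¹ := by
    intro p
    rw [hX.measureReal_dominationEvent]
    split_ifs
    · positivity
    · exact le_rfl
  -- Products of probabilities are at most 4^(-d), so they fit under the bound 3^(-d) used for
  -- intersections. Each of the two sums over at most 4n neighbours then costs 4n/3^d, giving the 8
  -- below.
  have h1 : ∀ p q : Fin n × Fin n,
      P.real (dominationEvent X p) * P.real (dominationEvent X q) ≤ (3 ^ d : ℝ)⁻¹ := by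
    intro p q
    calc _ ≤ (2 ^ d : ℝ)⁻¹ * (2 ^ d : ℝ)⁻¹ := by gcongr <;> exact hle _
      _ = (4 ^ d : ℝ)⁻¹ := by rw [← mul_inv, ← mul_pow]; norm_num
      _ ≤ _ := by gcongr; norm_num
  calc _ ≤ ∑ p : Fin n × Fin n, (8 * n * (3 ^ d : ℝ)⁻¹) := by
        refine Finset.sum_le_sum fun p _ => ?_
        have e1 := Finset.sum_le_card_nsmul (neighbours p)
          (fun q => P.real (dominationEvent X p) * P.real (dominationEvent X q)) _
          fun q _ => h1 p q
        have e2 := Finset.sum_le_card_nsmul ((neighbours p).erase p)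
          (fun q => P.real (dominationEvent X p ∩ dominationEvent X q)) _
          fun q hq => hX.measureReal_dominationEvent_inter_le hd (Finset.mem_of_mem_erase hq)
            (Finset.ne_of_mem_erase hq)
        rw [nsmul_eq_mul] at e1 e2
        have h3 : (0 : ℝ) ≤ (3 ^ d : ℝ)⁻¹ := by positivity
        nlinarith [mul_le_mul_of_nonneg_right (hcard p) h3,
          mul_le_mul_of_nonneg_right (hcard' p) h3]
    _ = _ := by
      simp only [Finset.sum_const, Finset.card_univ, Fintype.card_prod, Fintype.card_fin,
        nsmul_eq_mul]
      push_cast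
      ring

lemma integral_dominatedTripleCount_le (hX : IsUniformSample P X) :
    ∫ ω, (dominatedTripleCount fun i => X i ω : ℝ) ∂P ≤ n ^ 3 / 3 ^ d := by
  have hm : ∀ p, MeasurableSet (dominationEvent X p) :=
    measurableSet_dominationEvent hX.measurable
  have h : ∀ ω, (dominatedTripleCount fun i => X i ω : ℝ) =
      ∑ i, (occurrences (fun j => dominationEvent X (i, j)) Finset.univ ω : ℝ) *
        (occurrences (fun j => dominationEvent X (i, j)) Finset.univ ω - 1) := by
    intro ω
    simp only [dominatedTripleCount, dominatedCount_eq_occurrences]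
    push_cast
    refine Finset.sum_congr rfl fun i _ => ?_
    generalize occurrences (fun j => dominationEvent X (i, j)) Finset.univ ω = m
    rcases m with _ | m <;> simp
  simp_rw [h]
  rw [integral_finsetSum _ fun i _ => integrable_comp_occurrences
    (A := fun j => dominationEvent X (i, j)) (fun j => hm _) _ fun m => (m : ℝ) * (m - 1)]
  have h3 : ∀ i j l : Fin n, j ≠ l →
      P.real (dominationEvent X (i, j) ∩ dominationEvent X (i, l)) ≤ (3 ^ d : ℝ)⁻¹ := by
    intro i j l hjl
    have h0 : (0 : ℝ) ≤ (3 ^ d : ℝ)⁻¹ := by positivity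
    by_cases hij : i = j
    · simp [dominationEvent, hij]
    by_cases hil : i = l
    · simp [dominationEvent, hil]
    rw [← hX.measureReal_le_inter_le hij hil hjl]
    exact measureReal_mono fun ω h => ⟨h.1.2, h.2.2⟩
  calc _ = ∑ i, ∑ j, ∑ l ∈ Finset.univ.erase j,
        P.real (dominationEvent X (i, j) ∩ dominationEvent X (i, l)) :=
        Finset.sum_congr rfl fun i _ => integral_occurrences_mul_sub_one fun j => hm _
    _ ≤ ∑ i : Fin n, ∑ j : Fin n, ∑ l : Fin n, (3 ^ d : ℝ)⁻¹ := by
      refine Finset.sum_le_sum fun i _ => Finset.sum_le_sum fun j _ => ?_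
      refine (Finset.sum_le_sum fun l hl => h3 i j l (Finset.ne_of_mem_erase hl).symm).trans ?_
      exact Finset.sum_le_sum_of_subset_of_nonneg (Finset.erase_subset _ _)
        fun _ _ _ => by positivity
    _ = _ := by
      simp only [Finset.sum_const, Finset.card_univ, Fintype.card_fin, nsmul_eq_mul]
      ring

end IsUniformSample

/-! ### Moments of the Poisson law. -/

section Poisson

open scoped NNReal Nat

/-- The exact Stein identity E[m g(m)] = r E[g(m+1)], from m/m! = 1/(m-1)!. Taking g = 1 and g(m) =
m gives the first two moments. -/
lemma hasSum_poisson_shift {r : ℝ} {g : ℕ → ℝ} {s : ℝ}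
    (h : HasSum (fun m => Real.exp (-r) * r ^ m / m ! * g (m + 1)) s) :
    HasSum (fun m => Real.exp (-r) * r ^ m / m ! * (m * g m)) (r * s) := by
  rw [← hasSum_nat_add_iff' 1]
  simp only [Finset.range_one, Finset.sum_singleton, Nat.cast_zero, zero_mul, mul_zero, sub_zero]
  refine (h.mul_left r).congr_fun ?_
  intro m
  rw [Nat.factorial_succ]
  push_cast
  field_simp
  ring

lemma hasSum_poisson_mul (r : ℝ≥0) :
    HasSum (fun m => Real.exp (-r) * r ^ m / m ! * (m : ℝ)) r := by
  have h := hasSum_poisson_shift (r := r) (g := fun _ => 1) (s := 1)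
    (by simpa using hasSum_one_poissonMeasure r)
  simpa using h

lemma hasSum_poisson_mul_sq (r : ℝ≥0) :
    HasSum (fun m => Real.exp (-r) * r ^ m / m ! * (m : ℝ) ^ 2) (r * (r + 1)) := by
  simp_rw [pow_two]
  refine hasSum_poisson_shift (r := r) (g := fun m => (m : ℝ)) ?_
  refine ((hasSum_poisson_mul r).add (hasSum_one_poissonMeasure r)).congr_fun ?_
  intro m
  push_cast
  ring

lemma integral_cast_poissonMeasure (r : ℝ≥0) : ∫ m : ℕ, (m : ℝ) ∂(poissonMeasure r) = r := by
  rw [integral_poissonMeasure]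
  exact (hasSum_poisson_mul r).tsum_eq

lemma integral_cast_sq_poissonMeasure (r : ℝ≥0) :
    ∫ m : ℕ, (m : ℝ) ^ 2 ∂(poissonMeasure r) = r * (r + 1) := by
  rw [integral_poissonMeasure]
  exact (hasSum_poisson_mul_sq r).tsum_eq

lemma integrable_cast_sq_poissonMeasure (r : ℝ≥0) :
    Integrable (fun m : ℕ => (m : ℝ) ^ 2) (poissonMeasure r) := by
  rw [integrable_poissonMeasure_iff]
  simpa using (hasSum_poisson_mul_sq r).summable

lemma variance_cast_poissonMeasure (r : ℝ≥0) :
    variance (fun m : ℕ => (m : ℝ)) (poissonMeasure r) = r := by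
  rw [variance_eq_sub ((memLp_two_iff_integrable_sq (by fun_prop)).2
    (integrable_cast_sq_poissonMeasure r))]
  simp only [Pi.pow_apply]
  rw [integral_cast_sq_poissonMeasure, integral_cast_poissonMeasure]
  ring

end Poisson

/-! ### From Stein's identity to characteristic functions. -/

section CharFun

open Complex

/-- For k ≥ 1 the distance 2 between unit complex numbers suffices, so the Lipschitz constant is
uniform in `t`. -/
lemma norm_exp_natCast_sub_le (t : ℝ) (m k : ℕ) :
    ‖cexp (t * (m + k : ℕ) * I) - cexp (t * m * I)‖ ≤ 2 * (k : ℝ) := by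
  have h : ∀ j : ℕ, ‖cexp (t * j * I)‖ = 1 := fun j => by
    exact_mod_cast norm_exp_ofReal_mul_I (t * j)
  rcases k with _ | k
  · simp
  · refine (norm_sub_le _ _).trans ?_
    rw [h, h]
    push_cast
    linarith [Nat.cast_nonneg (α := ℝ) k]

variable {Ω : Type*} [MeasurableSpace Ω] {P : Measure Ω} [IsProbabilityMeasure P]

lemma hasDerivAt_integral_exp {W : Ω → ℕ} (hW : Measurable W) {m : ℕ} (hm : ∀ ω, W ω ≤ m)
    (t : ℝ) :
    HasDerivAt (fun t : ℝ => ∫ ω, cexp (t * W ω * I) ∂P)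
      (∫ ω, W ω * I * cexp (t * W ω * I) ∂P) t := by
  refine (hasDerivAt_integral_of_dominated_loc_of_deriv_le (μ := P) (s := Set.univ)
    (F := fun (t : ℝ) ω => cexp (t * W ω * I))
    (F' := fun (t : ℝ) ω => W ω * I * cexp (t * W ω * I)) (x₀ := t)
    (bound := fun _ => m)
    univ_mem (Eventually.of_forall fun t => ?_) ?_ ?_ (ae_of_all _ fun ω t _ => ?_)
    (integrable_const _) (ae_of_all _ fun ω t _ => ?_)).2
  · exact (integrable_comp_of_le hW hm fun k => cexp (t * k * I)).aestronglyMeasurable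
  · exact integrable_comp_of_le hW hm fun k => cexp (t * k * I)
  · exact (integrable_comp_of_le hW hm fun k => k * I * cexp (t * k * I)).aestronglyMeasurable
  · have : ‖cexp (t * W ω * I)‖ = 1 := by exact_mod_cast norm_exp_ofReal_mul_I (t * W ω)
    rw [norm_mul, this]
    simpa using hm ω
  · have h : HasDerivAt (fun t : ℝ => (t * W ω * I : ℂ)) (W ω * I) t := by
      simpa using ((ofRealCLM.hasDerivAt (x := t)).mul_const (W ω : ℂ)).mul_const I
    exact h.cexp.congr_deriv (mul_comm _ _)

/-- A bounded random variable that nearly satisfies Stein's identity for the Poisson law has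
nearly the characteristic function of that law. -/
theorem norm_integral_exp_sub_le {W : Ω → ℕ} (hW : Measurable W) {m : ℕ} (hm : ∀ ω, W ω ≤ m)
    {lam δ : ℝ} (hlam : 0 ≤ lam)
    (h : ∀ t : ℝ, ‖∫ ω, W ω * cexp (t * W ω * I) ∂P -
      lam * ∫ ω, cexp (t * (W ω + 1 : ℕ) * I) ∂P‖ ≤ δ) (t : ℝ) :
    ‖∫ ω, cexp (t * W ω * I) ∂P - cexp (lam * (cexp (t * I) - 1))‖ ≤
      Real.exp (2 * lam) * δ * |t| := by
  have hre : ∀ s : ℝ, (cexp (s * I) - 1).re = Real.cos s - 1 := fun s => by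
    simp [exp_ofReal_mul_I_re]
  -- Multiplying by the reciprocal of the Poisson characteristic function acts as an integrating
  -- factor: the derivative of the product contains only the Stein error.
  have hd : ∀ s : ℝ, HasDerivAt
      (fun s : ℝ => cexp (-lam * (cexp (s * I) - 1)) * ∫ ω, cexp (s * W ω * I) ∂P)
      (cexp (-lam * (cexp (s * I) - 1)) * I * (∫ ω, W ω * cexp (s * W ω * I) ∂P -
      lam * ∫ ω, cexp (s * (W ω + 1 : ℕ) * I) ∂P)) s := by
    intro s
    have h1 : HasDerivAt (fun s : ℝ => (s * I : ℂ)) I s := by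
      simpa using (ofRealCLM.hasDerivAt (x := s)).mul_const I
    have h2 := ((h1.cexp.sub_const 1).const_mul (-lam : ℂ)).cexp
    refine (h2.mul (hasDerivAt_integral_exp (P := P) hW hm s)).congr_deriv ?_
    have e1 : ∫ ω, cexp (s * (W ω + 1 : ℕ) * I) ∂P =
        cexp (s * I) * ∫ ω, cexp (s * W ω * I) ∂P := by
      rw [← integral_const_mul]
      congr 1 with ω
      rw [← Complex.exp_add]
      push_cast
      ring_nf
    have e2 : ∫ ω, W ω * I * cexp (s * W ω * I) ∂P =
        I * ∫ ω, W ω * cexp (s * W ω * I) ∂P := by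
      rw [← integral_const_mul]
      congr 1 with ω
      ring
    rw [e1, e2]
    ring
  -- The product equals 1 at 0, and the integrating factor has modulus exp(lam(1 - cos s)) ≤ exp(2
  -- lam).
  have hb := Convex.norm_image_sub_le_of_norm_hasDerivWithin_le (s := Set.univ)
    (C := Real.exp (2 * lam) * δ) (fun s _ => (hd s).hasDerivWithinAt) (fun s _ => by
      rw [norm_mul, norm_mul, norm_I, mul_one, Complex.norm_exp, ← ofReal_neg, re_ofReal_mul, hre]
      refine mul_le_mul (Real.exp_le_exp.2 ?_) (h s) (norm_nonneg _) (Real.exp_pos _).le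
      nlinarith [Real.neg_one_le_cos s]) convex_univ (Set.mem_univ 0) (Set.mem_univ t)
  simp only [ofReal_zero, zero_mul, Complex.exp_zero, sub_self, mul_zero, integral_const,
    probReal_univ, one_smul, mul_one, sub_zero, Real.norm_eq_abs] at hb
  refine le_trans ?_ hb
  have e3 : ∫ ω, cexp (t * W ω * I) ∂P - cexp (lam * (cexp (t * I) - 1)) =
      cexp (lam * (cexp (t * I) - 1)) *
        (cexp (-lam * (cexp (t * I) - 1)) * ∫ ω, cexp (t * W ω * I) ∂P - 1) := by
    rw [mul_sub (cexp _), ← mul_assoc, ← Complex.exp_add, neg_mul, add_neg_cancel]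
    simp
  rw [e3, norm_mul, Complex.norm_exp, re_ofReal_mul, hre]
  refine mul_le_of_le_one_left (norm_nonneg _) (Real.exp_le_one_iff.2 ?_)
  nlinarith [Real.cos_le_one t]

end CharFun

/-! ### Transfer from dominating pairs to non-Pareto points. -/

namespace IsUniformSample

variable {Ω : Type*} [MeasurableSpace Ω] {n d : ℕ} {P : Measure Ω} [IsProbabilityMeasure P]
  {X : Fin n → Ω → Fin d → ℝ}

lemma integrable_dominatedTripleCount (hX : IsUniformSample P X) :
    Integrable (fun ω => (dominatedTripleCount fun i => X i ω : ℝ)) P := by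
  refine integrable_comp_of_le (m := n * (n * n)) hX.measurable_dominatedTripleCount
    (fun ω => ?_) fun m => (m : ℝ)
  have h : ∀ i, dominatedCount (fun i => X i ω) i ≤ n := fun i => by
    rw [dominatedCount_eq_occurrences]
    simpa using occurrences_le_card (fun j => dominationEvent X (i, j)) Finset.univ ω
  refine (Finset.sum_le_card_nsmul _ _ (n * n) fun i _ =>
    Nat.mul_le_mul (h i) ((Nat.sub_le _ _).trans (h i))).trans ?_
  simp

lemma integral_nonParetoCount_le (hX : IsUniformSample P X) :
    ∫ ω, (nonParetoCount fun i => X i ω : ℝ) ∂P ≤ n * (n - 1) / 2 ^ d := by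
  rw [← hX.integral_dominatedPairCount]
  exact integral_mono (hX.integrable_comp_nonParetoCount fun m => (m : ℝ))
    (hX.integrable_comp_dominatedPairCount fun m => (m : ℝ))
    fun ω => Nat.cast_le.2 (nonParetoCount_le_dominatedPairCount _)

lemma le_integral_nonParetoCount (hX : IsUniformSample P X) :
    n * (n - 1) / 2 ^ d - n ^ 3 / 3 ^ d ≤ ∫ ω, (nonParetoCount fun i => X i ω : ℝ) ∂P := by
  have h := integral_mono (hX.integrable_comp_dominatedPairCount fun m => (m : ℝ))
    ((hX.integrable_comp_nonParetoCount fun m => (m : ℝ)).add hX.integrable_dominatedTripleCount)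
    fun ω => by
      simp only [Pi.add_apply]
      exact_mod_cast dominatedPairCount_le fun i => X i ω
  rw [hX.integral_dominatedPairCount, integral_add' (hX.integrable_comp_nonParetoCount
    fun m => (m : ℝ)) hX.integrable_dominatedTripleCount] at h
  linarith [hX.integral_dominatedTripleCount_le]

/-- Stein's bound for f(m) = m, where E[W f(W)] = E W² and λ E[f(W+1)] = λ(λ+1). -/
lemma abs_integral_dominatedPairCount_sq_sub_le (hX : IsUniformSample P X) (hd : 1 ≤ d) :
    |∫ ω, (dominatedPairCount fun i => X i ω : ℝ) ^ 2 ∂P -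
      n * (n - 1) / 2 ^ d * (n * (n - 1) / 2 ^ d + 1)| ≤ 8 * (n ^ 3 / 3 ^ d) := by
  have h := hX.norm_integral_dominatedPairCount_mul_sub_le hd (f := fun m => (m : ℂ)) (L := 1)
    (by intro m k; simp)
  have e1 : ∫ ω, ((dominatedPairCount fun i => X i ω : ℕ) : ℂ) *
      (dominatedPairCount fun i => X i ω : ℕ) ∂P =
      ((∫ ω, (dominatedPairCount fun i => X i ω : ℝ) ^ 2 ∂P : ℝ) : ℂ) := by
    refine Eq.trans ?_ integral_ofReal
    congr 1 with ω
    push_cast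
    ring
  have e2 : ∫ ω, (((dominatedPairCount fun i => X i ω) + 1 : ℕ) : ℂ) ∂P =
      ((n * (n - 1) / 2 ^ d + 1 : ℝ) : ℂ) := by
    have e3 : ∫ ω, ((dominatedPairCount fun i => X i ω : ℝ) + 1) ∂P =
        n * (n - 1) / 2 ^ d + 1 := by
      rw [integral_add (hX.integrable_comp_dominatedPairCount fun m => (m : ℝ))
        (integrable_const _), hX.integral_dominatedPairCount]
      simp
    rw [← e3]
    refine Eq.trans ?_ integral_ofReal
    congr 1 with ω
    push_cast
    rfl
  rw [e1, e2, ← Complex.ofReal_mul, ← Complex.ofReal_sub, Complex.norm_real, one_mul] at h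
  exact h

/-- The 16 is the Lipschitz constant 2 times the 8 of Stein's bound. The 2 pays for replacing the
pair count by the non-Pareto count: they differ by at most the triple count. -/
lemma norm_charFun_nonParetoCount_sub_le (hX : IsUniformSample P X) (hd : 1 ≤ d) (hn : 1 ≤ n)
    (t : ℝ) :
    ‖charFun (P.map fun ω => (nonParetoCount fun i => X i ω : ℝ)) t -
        Complex.exp ((n * (n - 1) / 2 ^ d : ℝ) * (Complex.exp (t * Complex.I) - 1))‖ ≤
      (16 * Real.exp (2 * (n * (n - 1) / 2 ^ d)) * |t| + 2) * (n ^ 3 / 3 ^ d) := by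
  have hlam : (0 : ℝ) ≤ n * (n - 1) / 2 ^ d := by
    have : (1 : ℝ) ≤ n := by exact_mod_cast hn
    have : (0 : ℝ) ≤ n - 1 := by linarith
    positivity
  have h1 := norm_integral_exp_sub_le (P := P) hX.measurable_dominatedPairCount
    (dominatedPairCount_le_card X) hlam
    (fun s => hX.norm_integral_dominatedPairCount_mul_sub_le hd
      (f := fun m => Complex.exp (s * m * Complex.I)) (norm_exp_natCast_sub_le s)) t
  rw [charFun_apply_real, integral_map hX.measurable_cast_nonParetoCount.aemeasurable (by fun_prop)]
  have h2 : ‖∫ ω, Complex.exp (t * (nonParetoCount fun i => X i ω : ℝ) * Complex.I) ∂P -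
      ∫ ω, Complex.exp (t * (dominatedPairCount fun i => X i ω) * Complex.I) ∂P‖ ≤
      2 * (n ^ 3 / 3 ^ d) := by
    have i1 := hX.integrable_comp_nonParetoCount fun m : ℕ =>
      Complex.exp (t * (m : ℝ) * Complex.I)
    have i2 := hX.integrable_comp_dominatedPairCount fun m : ℕ =>
      Complex.exp (t * m * Complex.I)
    rw [← integral_sub i1 i2]
    refine (norm_integral_le_of_norm_le (hX.integrable_dominatedTripleCount.const_mul 2)
      (ae_of_all _ fun ω => ?_)).trans ?_
    · have a1 := nonParetoCount_le_dominatedPairCount fun i => X i ω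
      have a2 := dominatedPairCount_le fun i => X i ω
      obtain ⟨k, hk⟩ := Nat.exists_eq_add_of_le a1
      rw [norm_sub_rev, hk]
      refine (norm_exp_natCast_sub_le t _ k).trans ?_
      have : k ≤ dominatedTripleCount fun i => X i ω := by lia
      gcongr
    · rw [integral_const_mul]
      linarith [hX.integral_dominatedTripleCount_le]
  refine (norm_sub_le_norm_sub_add_norm_sub _ _ _).trans ((add_le_add h2 h1).trans (le_of_eq ?_))
  ring

end IsUniformSample

/-! ### Limit theorems in terms of λ and n³/3^d. -/

section Limits

open scoped NNReal

variable {Ω : ℕ → Type*} [∀ k, MeasurableSpace (Ω k)] {P : ∀ k, Measure (Ω k)}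
  [∀ k, IsProbabilityMeasure (P k)]

lemma tendstoInProbability_zero_of_integral_le {Y Z : ∀ k, Ω k → ℝ} (hY : ∀ k ω, 0 ≤ Y k ω)
    (hYZ : ∀ k ω, Y k ω ≤ Z k ω) (hZ : ∀ k, Integrable (Z k) (P k)) {u : ℕ → ℝ}
    (hu : ∀ k, ∫ ω, Z k ω ∂(P k) ≤ u k) (hu0 : Tendsto u atTop (𝓝 0)) :
    TendstoInProbability P Y atTop 0 := by
  intro ε hε
  have h1 : Tendsto (fun k => ENNReal.ofReal (u k / ε)) atTop (𝓝 0) := by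
    simpa using ENNReal.tendsto_ofReal (hu0.div_const ε)
  refine tendsto_of_tendsto_of_tendsto_of_le_of_le tendsto_const_nhds h1 (fun _ => zero_le)
    fun k => ?_
  have h2 := mul_meas_ge_le_integral_of_nonneg
    (ae_of_all (P k) fun ω => (hY k ω).trans (hYZ k ω)) (hZ k) ε
  calc P k {ω | ε ≤ |Y k ω - 0|} ≤ P k {ω | ε ≤ Z k ω} := by
        refine measure_mono fun ω hω => ?_
        simp only [sub_zero, abs_of_nonneg (hY k ω), Set.mem_ofPred_eq] at hω
        exact hω.trans (hYZ k ω)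
    _ = ENNReal.ofReal ((P k).real {ω | ε ≤ Z k ω}) := (ofReal_measureReal (by simp)).symm
    _ ≤ _ := by
      refine ENNReal.ofReal_le_ofReal ?_
      rw [le_div_iff₀ hε]
      linarith [hu k]

/-- Convergence of the integral of a nonnegative continuous function, from convergence in
distribution and an asymptotically sharp upper bound. -/
lemma tendsto_integral_of_tendstoInDistribution_of_le {Ω' : Type*} [MeasurableSpace Ω']
    {P' : Measure Ω'} [IsProbabilityMeasure P'] {Y : ∀ k, Ω k → ℝ} {Z : Ω' → ℝ}
    (h : TendstoInDistribution Y atTop Z P P') {g : ℝ → ℝ} (hg : Continuous g) (hg0 : 0 ≤ g)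
    (hY : ∀ k, Integrable (fun ω => g (Y k ω)) (P k)) (hZ : Integrable (fun ω => g (Z ω)) P')
    {u : ℕ → ℝ} (hu : ∀ᶠ k in atTop, ∫ ω, g (Y k ω) ∂(P k) ≤ u k)
    (hu' : Tendsto u atTop (𝓝 (∫ ω, g (Z ω) ∂P'))) :
    Tendsto (fun k => ∫ ω, g (Y k ω) ∂(P k)) atTop (𝓝 (∫ ω, g (Z ω) ∂P')) := by
  -- The portmanteau inequality on open sets gives the Fatou-type lower bound, with no uniform
  -- integrability.
  have h1 := lintegral_le_liminf_lintegral_of_forall_isOpen_measure_le_liminf_measure hg hg0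
    fun G hG => ProbabilityMeasure.le_liminf_measure_open_of_tendsto h.tendsto hG
  simp only [ProbabilityMeasure.coe_mk] at h1
  have hm : Measurable fun x => ENNReal.ofReal (g x) := hg.measurable.ennreal_ofReal
  rw [lintegral_map' hm.aemeasurable h.aemeasurable_limit] at h1
  simp_rw [fun k => lintegral_map' (hm.aemeasurable (μ := (P k).map (Y k)))
    (h.forall_aemeasurable k)] at h1
  rw [← ofReal_integral_eq_lintegral_ofReal hZ (ae_of_all _ fun _ => hg0 _)] at h1
  simp_rw [← fun k => ofReal_integral_eq_lintegral_ofReal (hY k) (ae_of_all _ fun _ => hg0 _)]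
    at h1
  have h2 : limsup (fun k => ENNReal.ofReal (∫ ω, g (Y k ω) ∂(P k))) atTop ≤
      ENNReal.ofReal (∫ ω, g (Z ω) ∂P') := by
    rw [← (ENNReal.tendsto_ofReal hu').limsup_eq]
    exact limsup_le_limsup (hu.mono fun k hk => ENNReal.ofReal_le_ofReal hk)
  have h3 := (ENNReal.tendsto_toReal ENNReal.ofReal_ne_top).comp
    (tendsto_of_le_liminf_of_limsup_le h1 h2)
  rw [ENNReal.toReal_ofReal (integral_nonneg fun ω => hg0 (Z ω))] at h3
  refine h3.congr fun k => ?_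
  simp only [Function.comp]
  exact ENNReal.toReal_ofReal (integral_nonneg fun ω => hg0 (Y k ω))

variable {n d : ℕ → ℕ} {X : ∀ k, Fin (n k) → Ω k → Fin (d k) → ℝ} {r : ℝ≥0}

theorem tendstoInDistribution_nonParetoCount (hX : ∀ k, IsUniformSample (P k) (X k))
    (hn : ∀ᶠ k in atTop, 1 ≤ n k)
    (hd : ∀ᶠ k in atTop, 1 ≤ d k)
    (hlam : Tendsto (fun k => (n k * (n k - 1) / 2 ^ d k : ℝ)) atTop (𝓝 r))
    (hε : Tendsto (fun k => (n k ^ 3 / 3 ^ d k : ℝ)) atTop (𝓝 0)) :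
    TendstoInDistribution (fun k ω => (nonParetoCount fun i => X k i ω : ℝ)) atTop
      (fun m : ℕ => (m : ℝ)) P (poissonMeasure r) := by
  refine ⟨fun k => (hX k).measurable_cast_nonParetoCount.aemeasurable, by fun_prop, ?_⟩
  refine ProbabilityMeasure.tendsto_of_tendsto_charFun fun t => ?_
  simp only [ProbabilityMeasure.coe_mk]
  rw [charFun_map_cast_poissonMeasure]
  have h1 : Tendsto (fun k => Complex.exp ((n k * (n k - 1) / 2 ^ d k : ℝ) *
      (Complex.exp (t * Complex.I) - 1))) atTop
      (𝓝 (Complex.exp (r * (Complex.exp (t * Complex.I) - 1)))) :=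
    (Complex.continuous_exp.tendsto _).comp
      (((Complex.continuous_ofReal.tendsto _).comp hlam).mul_const _)
  have h2 : Tendsto (fun k => (16 * Real.exp (2 * (n k * (n k - 1) / 2 ^ d k)) * |t| + 2) *
      (n k ^ 3 / 3 ^ d k : ℝ)) atTop (𝓝 0) := by
    have := ((((Real.continuous_exp.tendsto _).comp (hlam.const_mul 2)).const_mul 16).mul_const
      |t|).add_const 2 |>.mul hε
    simpa using this
  have h3 : Tendsto (fun k => charFun ((P k).map fun ω => (nonParetoCount fun i => X k i ω : ℝ)) t -
      Complex.exp ((n k * (n k - 1) / 2 ^ d k : ℝ) * (Complex.exp (t * Complex.I) - 1)))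
      atTop (𝓝 0) := by
    refine squeeze_zero_norm' ?_ h2
    filter_upwards [hn, hd] with k hk hk'
    exact (hX k).norm_charFun_nonParetoCount_sub_le hk' hk t
  simpa using h3.add h1

theorem tendsto_integral_nonParetoCount (hX : ∀ k, IsUniformSample (P k) (X k))
    (hlam : Tendsto (fun k => (n k * (n k - 1) / 2 ^ d k : ℝ)) atTop (𝓝 r))
    (hε : Tendsto (fun k => (n k ^ 3 / 3 ^ d k : ℝ)) atTop (𝓝 0)) :
    Tendsto (fun k => ∫ ω, (nonParetoCount fun i => X k i ω : ℝ) ∂(P k)) atTop (𝓝 r) :=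
  tendsto_of_tendsto_of_tendsto_of_le_of_le (by simpa using hlam.sub hε) hlam
    (fun k => (hX k).le_integral_nonParetoCount) fun k => (hX k).integral_nonParetoCount_le

theorem tendsto_variance_nonParetoCount (hX : ∀ k, IsUniformSample (P k) (X k))
    (hn : ∀ᶠ k in atTop, 1 ≤ n k)
    (hd : ∀ᶠ k in atTop, 1 ≤ d k)
    (hlam : Tendsto (fun k => (n k * (n k - 1) / 2 ^ d k : ℝ)) atTop (𝓝 r))
    (hε : Tendsto (fun k => (n k ^ 3 / 3 ^ d k : ℝ)) atTop (𝓝 0)) :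
    Tendsto (fun k => variance (fun ω => (nonParetoCount fun i => X k i ω : ℝ)) (P k))
      atTop (𝓝 r) := by
  -- The upper bound is the second moment of the pair count, whose limit r(r+1) is already the
  -- Poisson second moment.
  have hsq := tendsto_integral_of_tendstoInDistribution_of_le
    (tendstoInDistribution_nonParetoCount hX hn hd hlam hε) (g := fun x => x ^ 2)
    (continuous_pow 2) (fun x => sq_nonneg x)
    (fun k => (hX k).integrable_comp_nonParetoCount fun m => (m : ℝ) ^ 2)
    (integrable_cast_sq_poissonMeasure r)
    (u := fun k => (n k * (n k - 1) / 2 ^ d k : ℝ) * (n k * (n k - 1) / 2 ^ d k + 1) +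
      8 * (n k ^ 3 / 3 ^ d k))
    (by
      filter_upwards [hd] with k hk
      have h1 := integral_mono ((hX k).integrable_comp_nonParetoCount fun m => (m : ℝ) ^ 2)
        ((hX k).integrable_comp_dominatedPairCount fun m => (m : ℝ) ^ 2) fun ω =>
          pow_le_pow_left₀ (Nat.cast_nonneg _)
            (Nat.cast_le.2 (nonParetoCount_le_dominatedPairCount fun i => X k i ω)) 2
      have h2 := (abs_le.1 ((hX k).abs_integral_dominatedPairCount_sq_sub_le hk)).2
      linarith)
    (by
      rw [integral_cast_sq_poissonMeasure]
      simpa using (hlam.mul (hlam.add_const 1)).add (hε.const_mul 8))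
  rw [integral_cast_sq_poissonMeasure] at hsq
  have h := hsq.sub ((tendsto_integral_nonParetoCount hX hlam hε).pow 2)
  rw [show (r : ℝ) * (r + 1) - r ^ 2 = r by ring] at h
  refine h.congr fun k => ?_
  rw [variance_eq_sub ((memLp_two_iff_integrable_sq
    (hX k).measurable_cast_nonParetoCount.aestronglyMeasurable).2
    ((hX k).integrable_comp_nonParetoCount fun m => (m : ℝ) ^ 2))]
  rfl

theorem tendstoInProbability_sum_exactDominatingCount (hX : ∀ k, IsUniformSample (P k) (X k))
    (hε : Tendsto (fun k => (n k ^ 3 / 3 ^ d k : ℝ)) atTop (𝓝 0)) :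
    TendstoInProbability P (fun k ω => ∑ s ∈ Finset.Icc 2 (n k - 1),
      (exactDominatingCount s (fun i => X k i ω) : ℝ)) atTop 0 :=
  tendstoInProbability_zero_of_integral_le (fun k ω => by positivity)
    (fun k ω => by exact_mod_cast sum_exactDominatingCount_le fun i => X k i ω)
    (fun k => (hX k).integrable_dominatedTripleCount)
    (fun k => (hX k).integral_dominatedTripleCount_le) hε

theorem tendstoInProbability_nonParetoCount (hX : ∀ k, IsUniformSample (P k) (X k))
    (hlam : Tendsto (fun k => (n k * (n k - 1) / 2 ^ d k : ℝ)) atTop (𝓝 0)) :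
    TendstoInProbability P (fun k ω => (nonParetoCount fun i => X k i ω : ℝ)) atTop 0 :=
  tendstoInProbability_zero_of_integral_le (fun k ω => by positivity) (fun k ω => le_rfl)
    (fun k => (hX k).integrable_comp_nonParetoCount fun m => (m : ℝ))
    (fun k => (hX k).integral_nonParetoCount_le) hlam

end Limits

/-! ### Monotonicity in the dimension and a lower-tail bound. -/

namespace IsUniformSample

variable {Ω : Type*} [MeasurableSpace Ω] {n d : ℕ} {P : Measure Ω} [IsProbabilityMeasure P]
  {X : Fin n → Ω → Fin d → ℝ}

/-- The points of a product space, restricted to some of their coordinates. -/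
lemma pi_comp_castLE {d' : ℕ} (h : d ≤ d') :
    IsUniformSample (Measure.pi fun _ : Fin n => Measure.pi fun _ : Fin d' => unitUniform)
      fun i ω k => ω i (Fin.castLE h k) := by
  have hm : Measurable fun (x : Fin d' → ℝ) (k : Fin d) => x (Fin.castLE h k) := by fun_prop
  refine ⟨fun i => hm.comp (measurable_pi_apply i), ?_, fun i => ?_⟩
  · exact iIndepFun_pi (μ := fun _ : Fin n => Measure.pi fun _ : Fin d' => unitUniform)
      (X := fun _ (x : Fin d' → ℝ) (k : Fin d) => x (Fin.castLE h k)) fun _ => hm.aemeasurable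
  · have h1 : (fun (ω : Fin n → Fin d' → ℝ) (k : Fin d) => ω i (Fin.castLE h k)) =
        (fun (x : Fin d' → ℝ) (k : Fin d) => x (Fin.castLE h k)) ∘ Function.eval i := rfl
    rw [h1, ← Measure.map_map hm (measurable_pi_apply i), (measurePreserving_eval _ i).map_eq]
    have h2 := ((iIndepFun_pi (μ := fun _ : Fin d' => unitUniform) (X := fun _ x => x)
      fun _ => aemeasurable_id).precomp (Fin.castLE_injective h)).map_fun_eq_pi_map
      fun k => (measurable_pi_apply _).aemeasurable
    refine h2.trans ?_
    congr 1 with k : 1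
    exact (measurePreserving_eval (fun _ : Fin d' => unitUniform) (Fin.castLE h k)).map_eq

lemma map_eq_pi (hX : IsUniformSample P X) :
    P.map (fun ω i => X i ω) = Measure.pi fun _ => Measure.pi fun _ => unitUniform := by
  rw [hX.indep.map_fun_eq_pi_map fun i => (hX.measurable i).aemeasurable]
  simp_rw [hX.map_eq]

lemma measurableSet_nonParetoCount_lt (n d : ℕ) (M : ℝ) :
    MeasurableSet {x : Fin n → Fin d → ℝ | (nonParetoCount x : ℝ) < M} :=
  measurableSet_lt (pi_comp_castLE le_rfl).measurable_cast_nonParetoCount measurable_const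

/-- Moves the question to the canonical product space, where samples of different dimensions are
coupled by forgetting coordinates. -/
lemma measure_nonParetoCount_lt (hX : IsUniformSample P X) (M : ℝ) :
    P {ω | (nonParetoCount fun i => X i ω : ℝ) < M} =
      (Measure.pi fun _ : Fin n => Measure.pi fun _ : Fin d => unitUniform)
        {x | (nonParetoCount x : ℝ) < M} := by
  rw [← hX.map_eq_pi, Measure.map_apply (measurable_pi_lambda _ hX.measurable)
    (measurableSet_nonParetoCount_lt n d M)]
  rfl

/-- The number of non-Pareto points stochastically decreases in the dimension. -/
lemma measure_nonParetoCount_lt_le (hX : IsUniformSample P X) {d' : ℕ} (h : d ≤ d') (M : ℝ) :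
    P {ω | (nonParetoCount fun i => X i ω : ℝ) < M} ≤
      (Measure.pi fun _ : Fin n => Measure.pi fun _ : Fin d' => unitUniform)
        {x | (nonParetoCount x : ℝ) < M} := by
  rw [hX.measure_nonParetoCount_lt, ← (pi_comp_castLE h).measure_nonParetoCount_lt]
  refine measure_mono fun x (hx : (nonParetoCount _ : ℝ) < M) => ?_
  have h1 : nonParetoCount x ≤ nonParetoCount fun i (k : Fin d) => x i (Fin.castLE h k) :=
    nonParetoCount_mono fun i j hij k => hij _
  exact (Nat.cast_le.2 h1).trans_lt hx

/-- If no triple occurs, the pair count is below M ≤ λ/2, hence at least λ/2 from its mean. Markov's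
inequality bounds the triples and Chebyshev's the deviation, with variance at most λ + 8n³/3^d. -/
lemma measureReal_nonParetoCount_lt_le_of_two_mul_le (hX : IsUniformSample P X) (hd : 1 ≤ d)
    {M : ℝ} (hpos : (0 : ℝ) < n * (n - 1) / 2 ^ d) (hM : 2 * M ≤ n * (n - 1) / 2 ^ d) :
    P.real {ω | (nonParetoCount fun i => X i ω : ℝ) < M} ≤
      n ^ 3 / 3 ^ d + 4 * (n * (n - 1) / 2 ^ d + 8 * (n ^ 3 / 3 ^ d)) /
        (n * (n - 1) / 2 ^ d) ^ 2 := by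
  have hW := hX.integral_dominatedPairCount
  have hW2 := (abs_le.1 (hX.abs_integral_dominatedPairCount_sq_sub_le hd)).2
  set lam : ℝ := n * (n - 1) / 2 ^ d with hlam
  have hi : Integrable (fun ω => ((dominatedPairCount fun i => X i ω : ℝ) - lam) ^ 2) P :=
    hX.integrable_comp_dominatedPairCount fun m => ((m : ℝ) - lam) ^ 2
  have h1 : ∫ ω, ((dominatedPairCount fun i => X i ω : ℝ) - lam) ^ 2 ∂P ≤
      lam + 8 * (n ^ 3 / 3 ^ d) := by
    have e : ∀ ω, ((dominatedPairCount fun i => X i ω : ℝ) - lam) ^ 2 =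
        (dominatedPairCount fun i => X i ω : ℝ) ^ 2 -
          2 * lam * (dominatedPairCount fun i => X i ω : ℝ) + lam ^ 2 := fun ω => by ring
    simp_rw [e]
    have i1 := hX.integrable_comp_dominatedPairCount fun m => (m : ℝ) ^ 2
    have i2 := (hX.integrable_comp_dominatedPairCount fun m => (m : ℝ)).const_mul (2 * lam)
    rw [integral_add (by exact i1.sub i2) (integrable_const _), integral_sub i1 i2, integral_const_mul, hW]
    simp only [integral_const, probReal_univ, one_smul]
    linarith
  have h2 := mul_meas_ge_le_integral_of_nonneg (ae_of_all P fun ω => sq_nonneg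
    ((dominatedPairCount fun i => X i ω : ℝ) - lam)) hi (lam ^ 2 / 4)
  have h3 := mul_meas_ge_le_integral_of_nonneg (ae_of_all P fun ω => Nat.cast_nonneg
    (dominatedTripleCount fun i => X i ω)) hX.integrable_dominatedTripleCount 1
  have h4 := hX.integral_dominatedTripleCount_le
  have hsub : {ω | (nonParetoCount fun i => X i ω : ℝ) < M} ⊆
      {ω | (1 : ℝ) ≤ (dominatedTripleCount fun i => X i ω : ℝ)} ∪
      {ω | lam ^ 2 / 4 ≤ ((dominatedPairCount fun i => X i ω : ℝ) - lam) ^ 2} := by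
    intro ω hω
    by_cases h0 : dominatedTripleCount (fun i => X i ω) = 0
    · right
      have h5 := dominatedPairCount_le fun i => X i ω
      rw [h0, add_zero] at h5
      have h6 : (dominatedPairCount fun i => X i ω : ℝ) < M :=
        (Nat.cast_le.2 h5).trans_lt hω
      change lam ^ 2 / 4 ≤ _
      nlinarith
    · left
      change (1 : ℝ) ≤ _
      exact Nat.one_le_cast.2 (Nat.one_le_iff_ne_zero.2 h0)
  refine (measureReal_mono hsub).trans ((measureReal_union_le _ _).trans (add_le_add ?_ ?_))
  · linarith
  · rw [le_div_iff₀ (by positivity)]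
    linarith

end IsUniformSample

/-! ### Asymptotics of λ and n³/3^d. -/

section Asymptotics

lemma pow_two_div_two_pow {n : ℕ} (hn : 1 ≤ n) (d : ℕ) :
    (n : ℝ) ^ 2 / 2 ^ d = Real.exp (-(Real.log 2 * (d - 2 / Real.log 2 * Real.log n))) := by
  have h2 : Real.log 2 ≠ 0 := (Real.log_pos one_lt_two).ne'
  have hn' : (0 : ℝ) < n := by exact_mod_cast hn
  have e : -(Real.log 2 * (d - 2 / Real.log 2 * Real.log n)) =
      Real.log n * (2 : ℕ) - Real.log 2 * d := by
    field_simp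
    push_cast
    ring
  rw [e, Real.exp_sub, ← Real.rpow_def_of_pos hn', ← Real.rpow_def_of_pos two_pos,
    Real.rpow_natCast, Real.rpow_natCast]

/-- From 2^11 = 2048 ≤ 2187 = 3^7. -/
lemma eleven_mul_log_two_le : 11 * Real.log 2 ≤ 7 * Real.log 3 := by
  have h := Real.log_le_log (x := 2 ^ 11) (y := 3 ^ 7) (by norm_num) (by norm_num)
  rw [Real.log_pow, Real.log_pow] at h
  exact_mod_cast h

/-- The factor 39/20 lies below the critical 2 but is large enough: 39/20 · 11/7 = 3 + 9/140, so 3^d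
beats n³ by a power of n. -/
lemma pow_three_div_three_pow_le {n : ℕ} (hn : 1 ≤ n) {d : ℕ}
    (hd : 39 / 20 * Real.log n / Real.log 2 ≤ d) :
    (n : ℝ) ^ 3 / 3 ^ d ≤ Real.exp (-(9 / 140 * Real.log n)) := by
  have hn' : (0 : ℝ) < n := by exact_mod_cast hn
  have e : (n : ℝ) ^ 3 / 3 ^ d = Real.exp (Real.log n * (3 : ℕ) - Real.log 3 * d) := by
    rw [Real.exp_sub, ← Real.rpow_def_of_pos hn', ← Real.rpow_def_of_pos three_pos,
      Real.rpow_natCast, Real.rpow_natCast]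
  rw [e, Real.exp_le_exp]
  rw [div_le_iff₀ (Real.log_pos one_lt_two)] at hd
  have := mul_le_mul_of_nonneg_right eleven_mul_log_two_le (Nat.cast_nonneg (α := ℝ) d)
  push_cast
  linarith

variable {n d : ℕ → ℕ}

lemma tendsto_log_natCast (hn : Tendsto n atTop atTop) :
    Tendsto (fun k => Real.log (n k)) atTop atTop :=
  Real.tendsto_log_atTop.comp (tendsto_natCast_atTop_atTop.comp hn)

lemma tendsto_pow_three_div_three_pow (hn : Tendsto n atTop atTop)
    (hd : ∀ᶠ k in atTop, 39 / 20 * Real.log (n k) / Real.log 2 ≤ d k) :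
    Tendsto (fun k => (n k ^ 3 / 3 ^ d k : ℝ)) atTop (𝓝 0) := by
  have h : Tendsto (fun k => Real.exp (-(9 / 140 * Real.log (n k)))) atTop (𝓝 0) :=
    Real.tendsto_exp_neg_atTop_nhds_zero.comp
      ((tendsto_log_natCast hn).const_mul_atTop (by norm_num))
  refine tendsto_of_tendsto_of_tendsto_of_le_of_le' tendsto_const_nhds h
    (Eventually.of_forall fun k => by positivity) ?_
  filter_upwards [hd, hn.eventually_ge_atTop 1] with k hk hk'
  exact pow_three_div_three_pow_le hk' hk

lemma eventually_mul_sub_one_div_two_pow (hn : Tendsto n atTop atTop) :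
    ∀ᶠ k in atTop, (n k * (n k - 1) / 2 ^ d k : ℝ) = (1 - (n k : ℝ)⁻¹) *
      Real.exp (-(Real.log 2 * (d k - 2 / Real.log 2 * Real.log (n k)))) := by
  filter_upwards [hn.eventually_ge_atTop 1] with k hk
  have hk' : (n k : ℝ) ≠ 0 := by positivity
  rw [← pow_two_div_two_pow hk]
  field_simp

lemma tendsto_one_sub_inv_natCast (hn : Tendsto n atTop atTop) :
    Tendsto (fun k => 1 - (n k : ℝ)⁻¹) atTop (𝓝 1) := by
  simpa using (tendsto_inv_atTop_zero.comp (tendsto_natCast_atTop_atTop (R := ℝ).comp hn)).const_sub 1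

lemma tendsto_mul_sub_one_div_two_pow (hn : Tendsto n atTop atTop) {c : ℝ}
    (hd : Tendsto (fun k => (d k : ℝ) - 2 / Real.log 2 * Real.log (n k)) atTop (𝓝 c)) :
    Tendsto (fun k => (n k * (n k - 1) / 2 ^ d k : ℝ)) atTop (𝓝 (2 ^ (-c))) := by
  rw [tendsto_congr' (eventually_mul_sub_one_div_two_pow hn)]
  have h := (tendsto_one_sub_inv_natCast hn).mul
    ((Real.continuous_exp.tendsto _).comp (hd.const_mul (Real.log 2)).neg)
  rw [one_mul, ← mul_neg, ← Real.rpow_def_of_pos two_pos] at h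
  exact h

lemma tendsto_mul_sub_one_div_two_pow_zero (hn : Tendsto n atTop atTop)
    (hd : Tendsto (fun k => (d k : ℝ) - 2 / Real.log 2 * Real.log (n k)) atTop atTop) :
    Tendsto (fun k => (n k * (n k - 1) / 2 ^ d k : ℝ)) atTop (𝓝 0) := by
  rw [tendsto_congr' (eventually_mul_sub_one_div_two_pow hn)]
  simpa using (tendsto_one_sub_inv_natCast hn).mul
    (Real.tendsto_exp_neg_atTop_nhds_zero.comp (hd.const_mul_atTop (Real.log_pos one_lt_two)))

lemma tendsto_mul_sub_one_div_two_pow_atTop (hn : Tendsto n atTop atTop)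
    (hd : Tendsto (fun k => (d k : ℝ) - 2 / Real.log 2 * Real.log (n k)) atTop atBot) :
    Tendsto (fun k => (n k * (n k - 1) / 2 ^ d k : ℝ)) atTop atTop := by
  rw [tendsto_congr' (eventually_mul_sub_one_div_two_pow hn)]
  exact (tendsto_one_sub_inv_natCast hn).pos_mul_atTop one_pos
    (Real.tendsto_exp_atTop.comp (tendsto_neg_atBot_atTop.comp
      (hd.const_mul_atBot (Real.log_pos one_lt_two))))

/-- Since 39/20 < 2, raising the dimension to this level stays in the regime λ → ∞; rounding up
costs at most 1. -/
lemma tendsto_max_ceil_sub_atBot (hn : Tendsto n atTop atTop)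
    (hd : Tendsto (fun k => (d k : ℝ) - 2 / Real.log 2 * Real.log (n k)) atTop atBot) :
    Tendsto (fun k => ((max (d k) ⌈39 / 20 * Real.log (n k) / Real.log 2⌉₊ : ℕ) : ℝ) -
      2 / Real.log 2 * Real.log (n k)) atTop atBot := by
  have h1 : Tendsto (fun k => 1 - 1 / 20 / Real.log 2 * Real.log (n k)) atTop atBot :=
    tendsto_atBot_add_const_left _ 1 (tendsto_neg_atTop_atBot.comp
      ((tendsto_log_natCast hn).const_mul_atTop
        (div_pos (by norm_num) (Real.log_pos one_lt_two))))
  rw [tendsto_atBot] at hd h1 ⊢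
  intro b
  filter_upwards [hd b, h1 b] with k hk hk'
  rw [sub_le_iff_le_add, Nat.cast_max, max_le_iff]
  refine ⟨by linarith, ?_⟩
  have h2 := Nat.ceil_lt_add_one (a := 39 / 20 * Real.log (n k) / Real.log 2)
    (div_nonneg (mul_nonneg (by norm_num) (Real.log_natCast_nonneg _))
      (Real.log_pos one_lt_two).le)
  have e : 39 / 20 * Real.log (n k) / Real.log 2 + 1 =
    (1 - 1 / 20 / Real.log 2 * Real.log (n k)) + 2 / Real.log 2 * Real.log (n k) := by ring
  linarith

lemma eventually_le_of_tendsto_sub (hn : Tendsto n atTop atTop) {c : ℝ}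
    (hd : Tendsto (fun k => (d k : ℝ) - 2 / Real.log 2 * Real.log (n k)) atTop (𝓝 c)) :
    ∀ᶠ k in atTop, 39 / 20 * Real.log (n k) / Real.log 2 ≤ d k := by
  have h1 : Tendsto (fun k => 1 / 20 / Real.log 2 * Real.log (n k)) atTop atTop :=
    (tendsto_log_natCast hn).const_mul_atTop (div_pos (by norm_num) (Real.log_pos one_lt_two))
  filter_upwards [hd.eventually_const_le (sub_one_lt c), h1.eventually_ge_atTop (1 - c)]
    with k hk hk'
  have e : 39 / 20 * Real.log (n k) / Real.log 2 =
    2 / Real.log 2 * Real.log (n k) - 1 / 20 / Real.log 2 * Real.log (n k) := by ring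
  linarith

lemma eventually_one_le_of_eventually_le (hn : Tendsto n atTop atTop)
    (hd : ∀ᶠ k in atTop, 39 / 20 * Real.log (n k) / Real.log 2 ≤ d k) :
    ∀ᶠ k in atTop, 1 ≤ d k := by
  filter_upwards [hd, (tendsto_log_natCast hn).eventually_gt_atTop 0] with k hk hk'
  have h : (0 : ℝ) < d k := lt_of_lt_of_le
    (div_pos (mul_pos (by norm_num) hk') (Real.log_pos one_lt_two)) hk
  exact_mod_cast h

end Asymptotics

/-! ### The subcritical case and the assembled theorem. -/

section Main

variable {Ω : ℕ → Type*} [∀ k, MeasurableSpace (Ω k)] {P : ∀ k, Measure (Ω k)}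
  [∀ k, IsProbabilityMeasure (P k)] {n d : ℕ → ℕ} {X : ∀ k, Fin (n k) → Ω k → Fin (d k) → ℝ}

theorem tendstoInProbabilityAtTop_nonParetoCount (hX : ∀ k, IsUniformSample (P k) (X k))
    (hn : Tendsto n atTop atTop)
    (hd : Tendsto (fun k => (d k : ℝ) - 2 / Real.log 2 * Real.log (n k)) atTop atBot) :
    TendstoInProbabilityAtTop P (fun k ω => (nonParetoCount fun i => X k i ω : ℝ)) atTop := by
  intro M
  -- The original dimension may be too small for n³/3^d to vanish; the raised one makes the
  -- second-moment bound effective and only decreases the count stochastically.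
  set d' : ℕ → ℕ := fun k => max (d k) ⌈39 / 20 * Real.log (n k) / Real.log 2⌉₊ with hd'
  have hle : ∀ᶠ k in atTop, 39 / 20 * Real.log (n k) / Real.log 2 ≤ d' k :=
    Eventually.of_forall fun k => (Nat.le_ceil _).trans (Nat.cast_le.2 (le_max_right _ _))
  have hlam := tendsto_mul_sub_one_div_two_pow_atTop (d := d') hn (tendsto_max_ceil_sub_atBot hn hd)
  have hε := tendsto_pow_three_div_three_pow hn hle
  have hbound : Tendsto (fun k => (n k ^ 3 / 3 ^ d' k : ℝ) + 4 * (n k * (n k - 1) / 2 ^ d' k +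
      8 * (n k ^ 3 / 3 ^ d' k)) / (n k * (n k - 1) / 2 ^ d' k) ^ 2) atTop (𝓝 0) := by
    have hi := tendsto_inv_atTop_zero.comp hlam
    have h := hε.add ((hi.add ((hε.mul (hi.pow 2)).const_mul 8)).const_mul 4)
    simp only [mul_zero, add_zero, zero_mul] at h
    refine h.congr' ?_
    filter_upwards [hlam.eventually_gt_atTop 0] with k hk
    simp only [Function.comp]
    generalize (n k * (n k - 1) / 2 ^ d' k : ℝ) = a at hk
    generalize (n k ^ 3 / 3 ^ d' k : ℝ) = b
    field_simp
  have hlt : Tendsto (fun k => P k {ω | (nonParetoCount fun i => X k i ω : ℝ) < M})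
      atTop (𝓝 0) := by
    have h0 : Tendsto (fun k => ENNReal.ofReal ((n k ^ 3 / 3 ^ d' k : ℝ) +
        4 * (n k * (n k - 1) / 2 ^ d' k + 8 * (n k ^ 3 / 3 ^ d' k)) /
          (n k * (n k - 1) / 2 ^ d' k) ^ 2)) atTop (𝓝 0) := by
      simpa using ENNReal.tendsto_ofReal hbound
    refine tendsto_of_tendsto_of_tendsto_of_le_of_le' tendsto_const_nhds h0
      (Eventually.of_forall fun _ => zero_le) ?_
    filter_upwards [eventually_one_le_of_eventually_le hn hle, hlam.eventually_gt_atTop 0,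
      hlam.eventually_ge_atTop (2 * M)] with k h1 h2 h3
    refine ((hX k).measure_nonParetoCount_lt_le (d' := d' k) (le_max_left _ _) M).trans ?_
    rw [← ofReal_measureReal (measure_ne_top _ _)]
    -- With equal dimensions the truncation in `pi_comp_castLE` is the identity, so the coordinates
    -- of the product space are themselves a uniform sample.
    exact ENNReal.ofReal_le_ofReal
      ((IsUniformSample.pi_comp_castLE le_rfl).measureReal_nonParetoCount_lt_le_of_two_mul_le
        h1 h2 h3)
  have h1 := ENNReal.Tendsto.sub (tendsto_const_nhds (x := (1 : ENNReal))) hlt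
    (Or.inl ENNReal.one_ne_top)
  rw [tsub_zero] at h1
  refine h1.congr fun k => ?_
  rw [← prob_compl_eq_one_sub
    (measurableSet_lt (hX k).measurable_cast_nonParetoCount measurable_const)]
  congr 1 with ω
  simp

end Main

theorem theorem1
    (d : ℕ → ℕ)
    {Ω : ℕ → Type*} [∀ n, MeasurableSpace (Ω n)]
    (P : ∀ n, Measure (Ω n)) [∀ n, IsProbabilityMeasure (P n)]
    -- for each `n`, a sample of `n` i.i.d. uniform points in the cube `[0,1]^(d n)`
    (X : ∀ n, Fin n → Ω n → (Fin (d n) → ℝ))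
    (hX_meas : ∀ n i, Measurable (X n i))
    (hX_indep : ∀ n, iIndepFun (X n) (P n))
    (hX_unif : ∀ n i, pdf.IsUniform (X n i) (Set.Icc 0 1) (P n) volume)
    -- the subsequence of sample sizes along which the assumptions hold
    (φ : ℕ → ℕ) (hφ : StrictMono φ) :
    (Tendsto (fun k => (d (φ k) : ℝ) - 2 / Real.log 2 * Real.log (φ k)) atTop atBot →
      TendstoInProbabilityAtTop (fun k => P (φ k))
        (fun k ω => (φ k : ℝ) - paretoCount fun i => X (φ k) i ω) atTop) ∧
    (∀ c : ℝ,
      Tendsto (fun k => (d (φ k) : ℝ) - 2 / Real.log 2 * Real.log (φ k)) atTop (𝓝 c) →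
      TendstoInDistribution
        (fun k ω => (φ k : ℝ) - paretoCount fun i => X (φ k) i ω) atTop
        (fun m : ℕ => (m : ℝ)) (fun k => P (φ k))
        (poissonMeasure (Real.toNNReal ((2 : ℝ) ^ (-c)))) ∧
      Tendsto (fun k => ∫ ω, ((φ k : ℝ) - paretoCount fun i => X (φ k) i ω) ∂(P (φ k)))
        atTop (𝓝 ((2 : ℝ) ^ (-c))) ∧
      ∫ m : ℕ, (m : ℝ) ∂(poissonMeasure (Real.toNNReal ((2 : ℝ) ^ (-c)))) = (2 : ℝ) ^ (-c) ∧
      Tendsto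
        (fun k => variance (fun ω => (φ k : ℝ) - paretoCount fun i => X (φ k) i ω) (P (φ k)))
        atTop (𝓝 ((2 : ℝ) ^ (-c))) ∧
      variance (fun m : ℕ => (m : ℝ)) (poissonMeasure (Real.toNNReal ((2 : ℝ) ^ (-c)))) =
        (2 : ℝ) ^ (-c) ∧
      TendstoInProbability (fun k => P (φ k))
        (fun k ω => ∑ r ∈ Finset.Icc 2 (φ k - 1),
          (exactDominatingCount r (fun i => X (φ k) i ω) : ℝ)) atTop 0) ∧
    (Tendsto (fun k => (d (φ k) : ℝ) - 2 / Real.log 2 * Real.log (φ k)) atTop atTop →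
      TendstoInProbability (fun k => P (φ k))
        (fun k ω => (φ k : ℝ) - paretoCount fun i => X (φ k) i ω) atTop 0) := by
  have hX : ∀ n, IsUniformSample (P n) (X n) := fun n =>
    ⟨hX_meas n, hX_indep n, fun i => (hX_unif n i).trans (cond_Icc_eq_pi _)⟩
  have hXφ : ∀ k, IsUniformSample (P (φ k)) (X (φ k)) := fun k => hX (φ k)
  have hφ' : Tendsto φ atTop atTop := hφ.tendsto_atTop
  simp_rw [nat_sub_paretoCount]
  refine ⟨tendstoInProbabilityAtTop_nonParetoCount hXφ hφ', fun c hc => ?_, fun hd =>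
    tendstoInProbability_nonParetoCount hXφ (tendsto_mul_sub_one_div_two_pow_zero hφ' hd)⟩
  have hr : ((2 : ℝ) ^ (-c)).toNNReal = (2 : ℝ) ^ (-c) :=
    Real.coe_toNNReal _ (Real.rpow_nonneg zero_le_two _)
  have hlam := tendsto_mul_sub_one_div_two_pow hφ' hc
  have hle := eventually_le_of_tendsto_sub hφ' hc
  have hd := eventually_one_le_of_eventually_le hφ' hle
  have hε := tendsto_pow_three_div_three_pow hφ' hle
  have hn := hφ'.eventually_ge_atTop 1
  rw [← hr] at hlam
  refine ⟨tendstoInDistribution_nonParetoCount hXφ hn hd hlam hε, ?_, ?_, ?_, ?_,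
    tendstoInProbability_sum_exactDominatingCount hXφ hε⟩
  · exact hr ▸ tendsto_integral_nonParetoCount hXφ hlam hε
  · exact (integral_cast_poissonMeasure _).trans hr
  · exact hr ▸ tendsto_variance_nonParetoCount hXφ hn hd hlam hε
  · exact (variance_cast_poissonMeasure _).trans hr
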